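/- Let $K$ be a field, let $n\ge 0$ and $d\ge 1$ be integers, $[n]=\{1,\dots,n\}$ and $S=K[x_1,\dots,x_n]$ with the standard grading. A $d$-uniform clutter $\mathcal C$ on $[n]$ is a set of $d$-subsets of $[n]$, called circuits. Its circuit ideal $I(\bar{\mathcal C})\subset S$ is generated by the monomials $\prod_{j\in F}x_j$, where $F$ ranges over the $d$-subsets of $[n]$ with $F\notin\mathcal C$ (it is $0$ if there are none). A $(d-1)$-subset $e$ of $[n]$ contained in some circuit is called simplicial in $\mathcal C$ if every $d$-subset of $e\cup N_{\mathcal C}(e)$ belongs to $\mathcal C$, where $N_{\mathcal C}(e)=\{c\in[n] : e\cup\{c\}\in\mathcal C\}$. Put $\mathcal C\setminus e=\{F\in\mathcal C : e\not\subset F\}$. A simplicial order on $\mathcal C$ is a finite (possibly empty) sequence $e_1,\dots,e_r$ such that, with $\mathcal C_0=\mathcal C$ and $\mathcal C_i=\mathcal C_{i-1}\setminus e_i$, each $e_i$ is simplicial in $\mathcal C_{i-1}$, and $\mathcal C_r=\emptyset$. The clutter $\mathcal C$ is chordal if it has a simplicial order, and $\{N_1,\dots,N_r\}$ with $N_i=|N_{\mathcal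 C_{i-1}}(e_i)|$ is then the multiset of $\mathcal C$ associated with that order. **Corollary 3.1.** Let $\mathcal C$ be a $d$-uniform chordal clutter on $[n]$ and let $\{N_1,\dots,N_r\}$ be the multiset of $\mathcal C$ associated with any of its simplicial orders. Then $I(\bar{\mathcal C})$ has a graded minimal free $S$-resolution $\cdots\to F_1\to F_0\to I(\bar{\mathcal C})\to 0$ with all $F_i$ of finite rank, and for every such resolution the Betti numbers $\beta_i=\beta_i(I(\bar{\mathcal C}))=\operatorname{rank}F_i$ satisfy, in $\mathbb Z[t]$, $$1+\sum_{i=0}^{n-1}(-1)^{i+1}\beta_i\,t^{i+d}=\sum_{i=0}^{d-1}\binom ni t^i(1-t)^{n-i}+t^{d-1}\sum_{i=1}^r\Bigl((1-t)^{n-N_i-d+1}-(1-t)^{n-d+1}\Bigr),$$ where summands with $\binom ni=0$ are read as $0$. -/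

import Mathlib

/-- A `d`-uniform clutter on the vertex set `[n]` (modelled by `Fin n`): a collection of
`d`-subsets, called circuits. (Distinct sets of the same size are never contained in each other.) -/
structure UniformClutter (n d : ℕ) where
  circuits : Finset (Finset (Fin n))
  card_eq : ∀ F ∈ circuits, F.card = d

namespace UniformClutter

variable {n d : ℕ}

/-- The complement: all `d`-subsets of `[n]` that are not circuits. -/
def compl (C : UniformClutter n d) : UniformClutter n d where
  circuits := Finset.univ.filter fun F => F.card = d ∧ F ∉ C.circuits
  card_eq := fun _ hF => (Finset.mem_filter.mp hF).2.1

/-- The ideal `I(C)` generated by the squarefree monomials `x_F`, `F` a circuit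
(the zero ideal if there is no circuit). -/
noncomputable def ideal (K : Type*) [Field K] (C : UniformClutter n d) :
    Ideal (MvPolynomial (Fin n) K) :=
  Ideal.span {p | ∃ F ∈ C.circuits, p = ∏ j ∈ F, MvPolynomial.X j}

/-- The circuit ideal of `C`: the ideal of the complementary clutter. -/
noncomputable def circuitIdeal (K : Type*) [Field K] (C : UniformClutter n d) :
    Ideal (MvPolynomial (Fin n) K) :=
  C.compl.ideal K

/-- `V` is a clique: all its `d`-subsets are circuits. -/
def IsClique (C : UniformClutter n d) (V : Finset (Fin n)) : Prop :=
  ∀ F ⊆ V, F.card = d → F ∈ C.circuits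

/-- A submaximal circuit: a `(d-1)`-subset of some circuit. -/
def IsSubmaximal (C : UniformClutter n d) (e : Finset (Fin n)) : Prop :=
  e.card + 1 = d ∧ ∃ F ∈ C.circuits, e ⊆ F

/-- The open neighborhood `{c | e ∪ {c} ∈ C}`. -/
def nbhd (C : UniformClutter n d) (e : Finset (Fin n)) : Finset (Fin n) :=
  Finset.univ.filter fun c => e ∪ {c} ∈ C.circuits

/-- The closed neighborhood. -/
def closedNbhd (C : UniformClutter n d) (e : Finset (Fin n)) : Finset (Fin n) :=
  e ∪ C.nbhd e

/-- A simplicial submaximal circuit: its closed neighborhood is a clique. -/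
def IsSimplicial (C : UniformClutter n d) (e : Finset (Fin n)) : Prop :=
  C.IsSubmaximal e ∧ C.IsClique (C.closedNbhd e)

/-- The deletion `C \ e`: the circuits not containing `e`. -/
def deletion (C : UniformClutter n d) (e : Finset (Fin n)) : UniformClutter n d where
  circuits := C.circuits.filter fun F => ¬ e ⊆ F
  card_eq := fun F hF => C.card_eq F (Finset.mem_filter.mp hF).1

/-- Chordal clutters. -/
inductive IsChordal : UniformClutter n d → Prop
  | empty (C : UniformClutter n d) (h : C.circuits = ∅) : IsChordal C
  | step (C : UniformClutter n d) (e : Finset (Fin n)) (he : C.IsSimplicial e)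
      (h : IsChordal (C.deletion e)) : IsChordal C

/-- `e₁, …, e_r` is a simplicial order on `C`: each `e_i` is simplicial in
`C \ e₁ \ ⋯ \ e_{i-1}`, and `C \ e₁ \ ⋯ \ e_r` has no circuits. -/
def IsSimplicialOrder : UniformClutter n d → List (Finset (Fin n)) → Prop
  | C, [] => C.circuits = ∅
  | C, e :: es => C.IsSimplicial e ∧ IsSimplicialOrder (C.deletion e) es

/-- The multiset `{N₁, …, N_r}` of a sequence `e₁, …, e_r`, where `N_i` is the size of the open
neighborhood of `e_i` in `C \ e₁ \ ⋯ \ e_{i-1}`. -/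
def simplicialMultiset : UniformClutter n d → List (Finset (Fin n)) → Multiset ℕ
  | _, [] => 0
  | C, e :: es => (C.nbhd e).card ::ₘ simplicialMultiset (C.deletion e) es

/-- `N` is the simplicial multiset of `C` associated with some simplicial order. -/
def HasMultiset (C : UniformClutter n d) (N : Multiset ℕ) : Prop :=
  ∃ es, C.IsSimplicialOrder es ∧ C.simplicialMultiset es = N

/-- Every chordal clutter has a multiset. -/
theorem IsChordal.exists_hasMultiset {C : UniformClutter n d} (h : C.IsChordal) :
    ∃ N, C.HasMultiset N := by
  induction h with
  | empty C h => exact ⟨_, [], h, rfl⟩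
  | step C e he _ ih =>
    obtain ⟨_, es, hes, _⟩ := ih
    exact ⟨_, e :: es, ⟨he, hes⟩, rfl⟩

end UniformClutter

/-- A graded minimal free resolution
`⋯ → F₂ → F₁ → F₀ → I → 0` of an ideal `I` of `S = K[x₁, …, x_n]` (standard grading).
The module `F_i` is the finite direct sum of the `S(-deg i j)`, `j : ι i`. The map `F₀ → I` sends
the `j`-th basis vector to `gen j`, and `F_{i+1} → F_i` is given by the matrix `diff i`. -/
structure GradedMinimalFreeResolution {K : Type*} [Field K] {n : ℕ}
    (I : Ideal (MvPolynomial (Fin n) K)) where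
  ι : ℕ → Type
  [fintype : ∀ i, Fintype (ι i)]
  deg : ∀ i, ι i → ℕ
  gen : ι 0 → MvPolynomial (Fin n) K
  diff : ∀ i, Matrix (ι i) (ι (i + 1)) (MvPolynomial (Fin n) K)
  /-- The augmentation is homogeneous of degree `0`. -/
  gen_homogeneous : ∀ j, (gen j).IsHomogeneous (deg 0 j)
  /-- The differentials are homogeneous of degree `0`. -/
  diff_homogeneous : ∀ i j k, diff i j k = 0 ∨
    ∃ m, deg (i + 1) k = deg i j + m ∧ (diff i j k).IsHomogeneous m
  /-- The augmentation is onto `I`. -/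
  span_gen : Ideal.span (Set.range gen) = I
  /-- Exactness at `F₀`. -/
  exact_zero : Function.Exact (diff 0).mulVecLin
    (Fintype.linearCombination (MvPolynomial (Fin n) K) gen)
  /-- Exactness at `F_{i+1}`. -/
  exact_succ : ∀ i, Function.Exact (diff (i + 1)).mulVecLin (diff i).mulVecLin
  /-- Minimality: the image of `F_{i+1}` lies in `(x₁, …, x_n) F_i`. -/
  minimal : ∀ i j k, MvPolynomial.constantCoeff (diff i j k) = 0

/-- The rank of the free module `F_i`, i.e. the `i`-th Betti number computed by the resolution. -/
def GradedMinimalFreeResolution.betti {K : Type*} [Field K] {n : ℕ}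
    {I : Ideal (MvPolynomial (Fin n) K)} (F : GradedMinimalFreeResolution I) (i : ℕ) : ℕ :=
  letI := F.fintype i
  Fintype.card (F.ι i)

/-!
The circuit ideal `I(C)` of a chordal clutter has a linear resolution, so its Betti numbers can be
read off from its Hilbert series; both facts are proved by following a simplicial order.

Let `e` be simplicial in `C`, and let `x_e` be the product of the variables in `e`. Adding `x_e` to
`I(C)` and to `I(C \ e)` gives the same ideal `J` (`squarefreeIdeal_insert_deletion`). The colon
ideals of `I(C)` and `I(C \ e)` by `x_e` are generated by the variables outside the closed
neighborhood of `e` (a clique) and outside `e`, respectively. So `J / I(C)` and `J / I(C \ e)` are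
polynomial rings on the remaining variables, shifted by `d - 1`. Such a module has regularity
`d - 1`; passing from `I(C \ e)` to `J` (an extension) and from `J` to `I(C)` (a kernel) therefore
preserves regularity at most `d` (`IsSimplicial.isRegular`), and the Hilbert series change by
explicit terms (`IsSimplicial.numerator`). A simplicial order ends with the empty clutter, whose
ideal is generated by all squarefree monomials of degree `d`; it is treated by induction on `d` in the same
way (`isRegular_card_eq`, `numerator_card_eq`).

Regularity is expressed by exactness of the Koszul complex in high degrees (`Grading.IsRegular`).
Dimension shifting (`Grading.IsLinear.syzygies`) turns it into a statement on an arbitrary minimal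
resolution: the generators of the `i`-th module all have degree `i + d`. Hence the alternating
generating function of the Betti numbers agrees, in any finite range of degrees, with the numerator
of the Hilbert series (`GradedMinimalFreeResolution.X_pow_dvd_sub_numerator`). As the right hand
side has degree at most `n`, the first `n` Betti numbers suffice.

A minimal resolution exists because a finitely generated homogeneous submodule has a least number
of homogeneous generators, and a relation with an invertible coefficient would make one of these
superfluous (`Grading.IsHomogeneous.exists_minimal_generators`).
-/

/-! ### Degrees of polynomials -/

section Polynomial

open Polynomial

lemma natDegree_one_sub_X_pow_le (k : ℕ) : ((1 - X : ℤ[X]) ^ k).natDegree ≤ k := by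
  have h : (1 - X : ℤ[X]).natDegree ≤ 1 := by compute_degree
  simpa using natDegree_pow_le_of_le k h

lemma natDegree_X_pow_mul_sum_le {n d : ℕ} (hd : 1 ≤ d) (N : Multiset ℕ) :
    ((X : ℤ[X]) ^ (d - 1) * (N.map fun k =>
      ((1 - X) ^ (n + 1 - d - k) - (1 - X) ^ (n + 1 - d) : ℤ[X])).sum).natDegree ≤ n := by
  induction N using Multiset.induction_on with
  | empty => simp
  | cons k N ih =>
    rw [Multiset.map_cons, Multiset.sum_cons, mul_add]
    refine natDegree_add_le_of_degree_le ?_ ih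
    rcases le_or_gt d (n + 1) with h | h
    · have h1 : ((1 - X) ^ (n + 1 - d - k) - (1 - X) ^ (n + 1 - d) : ℤ[X]).natDegree ≤
          n + 1 - d :=
        natDegree_sub_le_of_le ((natDegree_one_sub_X_pow_le _).trans (Nat.sub_le _ _))
          (natDegree_one_sub_X_pow_le _) |>.trans (max_self _).le
      exact (natDegree_mul_le_of_le (natDegree_X_pow_le _) h1).trans (by omega)
    · -- Both exponents are truncated to `0`.
      rw [show n + 1 - d - k = 0 by omega, show n + 1 - d = 0 by omega]
      simp

lemma natDegree_sum_choose_le (n d : ℕ) :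
    (∑ i ∈ Finset.range d, (n.choose i : ℤ[X]) * X ^ i * (1 - X) ^ (n - i)).natDegree ≤ n := by
  refine natDegree_sum_le_of_forall_le _ _ fun i _ => ?_
  rcases le_or_gt i n with h | h
  · refine (natDegree_mul_le_of_le (natDegree_mul_le_of_le (natDegree_natCast _).le
      (natDegree_X_pow_le _)) (natDegree_one_sub_X_pow_le _)).trans (by omega)
  · rw [Nat.choose_eq_zero_of_lt h]
    simp

lemma natDegree_one_add_sum_lt {n d : ℕ} (hd : 1 ≤ d) (b : ℕ → ℕ) :
    (1 + ∑ i ∈ Finset.range n,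
      (-1) ^ (i + 1) * (b i : ℤ[X]) * X ^ (i + d) : ℤ[X]).natDegree < d + n := by
  have h : (1 + ∑ i ∈ Finset.range n,
      (-1) ^ (i + 1) * (b i : ℤ[X]) * X ^ (i + d) : ℤ[X]).natDegree ≤ d + n - 1 := by
    refine natDegree_add_le_of_degree_le (by simp)
      (natDegree_sum_le_of_forall_le _ _ fun i hi => ?_)
    have hi := Finset.mem_range.1 hi
    have h1 : ((-1) ^ (i + 1) * (b i : ℤ[X])) = C ((-1) ^ (i + 1) * (b i : ℤ)) := by simp
    rw [h1]
    exact (natDegree_C_mul_X_pow_le _ _).trans (by omega)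
  omega

lemma eq_of_X_pow_dvd_coe_sub {p q : ℤ[X]} {m : ℕ} (hp : p.natDegree < m) (hq : q.natDegree < m)
    (h : PowerSeries.X ^ m ∣ (p : PowerSeries ℤ) - (q : PowerSeries ℤ)) : p = q := by
  ext k
  rcases lt_or_ge k m with hk | hk
  · have := PowerSeries.X_pow_dvd_iff.1 h k hk
    rwa [map_sub, coeff_coe, coeff_coe, sub_eq_zero] at this
  · rw [coeff_eq_zero_of_natDegree_lt (hp.trans_le hk),
      coeff_eq_zero_of_natDegree_lt (hq.trans_le hk)]

end Polynomial

/-! ### The Koszul differential -/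

namespace Koszul

open Finset

variable {ι R V W : Type*} [LinearOrder ι] [Fintype ι] [CommRing R]
  [AddCommGroup V] [Module R V] [AddCommGroup W] [Module R W]

/-- The sign `(-1)^#{t ∈ T | t < c}` which `c` picks up when it is moved to its place in the
increasingly ordered set `T ∪ {c}`. -/
def sign (R : Type*) [CommRing R] (c : ι) (T : Finset ι) : R := (-1) ^ #{t ∈ T | t < c}

omit [Fintype ι] in
lemma sign_mul_self (c : ι) (T : Finset ι) : sign R c T * sign R c T = 1 := by
  rw [sign, ← mul_pow]; simp

omit [Fintype ι] in
lemma sign_insert {b c : ι} {T : Finset ι} (hb : b ∉ T) :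
    sign R c (insert b T) = if b < c then -sign R c T else sign R c T := by
  unfold sign
  rw [filter_insert]
  split_ifs
  · rw [card_insert_of_notMem (by simp [hb]), pow_succ]; ring
  · rfl

omit [Fintype ι] in
lemma sign_mul_sign_insert {b c : ι} {T : Finset ι} (hbc : b ≠ c) (hb : b ∉ T) (hc : c ∉ T) :
    sign R b (insert c T) * sign R c (insert b T) = -(sign R b T * sign R c T) := by
  rw [sign_insert hb, sign_insert hc]
  rcases lt_or_gt_of_ne hbc with h | h
  · rw [if_neg h.not_gt, if_pos h]; ring
  · rw [if_pos h, if_neg h.not_gt]; ring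

/-- The Koszul differential of the sequence `x` on `V`. The value `f T` is the coefficient of the
wedge product of the basis vectors indexed by `T`; all exterior degrees are treated at once. -/
def differential (x : ι → R) : (Finset ι → V) →ₗ[R] (Finset ι → V) where
  toFun f T := ∑ c ∈ Tᶜ, (sign R c T * x c) • f (insert c T)
  map_add' f g := by ext T; simp [sum_add_distrib]
  map_smul' r f := by ext T; simp [smul_sum, smul_comm r]

lemma differential_apply (x : ι → R) (f : Finset ι → V) (T : Finset ι) :
    differential x f T = ∑ c ∈ Tᶜ, (sign R c T * x c) • f (insert c T) := rfl

lemma map_differential (x : ι → R) (φ : V →ₗ[R] W) (f : Finset ι → V) (T : Finset ι) :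
    φ (differential x f T) = differential x (fun T => φ (f T)) T := by
  simp [differential_apply]

lemma differential_differential (x : ι → R) (f : Finset ι → V) :
    differential x (differential x f) = 0 := by
  ext T
  simp only [differential_apply, smul_sum, smul_smul, Pi.zero_apply]
  rw [sum_sigma']
  refine sum_involution (fun p _ => ⟨p.2, p.1⟩) ?_ ?_ ?_ ?_
  · rintro ⟨b, c⟩ h
    simp only [mem_sigma, mem_compl, mem_insert, not_or] at h
    obtain ⟨hb, hcb, hc⟩ := h
    have key : sign R b T * sign R c (insert b T) + sign R c T * sign R b (insert c T) = 0 := by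
      rw [sign_insert hb, sign_insert hc]
      rcases lt_or_gt_of_ne hcb with h | h
      · rw [if_neg h.not_gt, if_pos h]; ring
      · rw [if_pos h, if_neg h.not_gt]; ring
    simp only
    rw [insert_comm b c, ← add_smul]
    convert zero_smul R _
    linear_combination x b * x c * key
  · rintro ⟨b, c⟩ h _ h'
    simp only [mem_sigma, mem_compl, mem_insert, not_or] at h
    exact h.2.1 (congrArg Sigma.fst h')
  · rintro ⟨b, c⟩ h
    simp only [mem_sigma, mem_compl, mem_insert, not_or] at h ⊢
    exact ⟨h.2.2, fun e => h.2.1 e.symm, h.1⟩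
  · rintro ⟨b, c⟩ _
    rfl

/-- Exterior multiplication by the basis vector with index `c`. -/
def wedge (R : Type*) [CommRing R] [Module R V] (c : ι) (f : Finset ι → V) (T : Finset ι) : V :=
  if c ∈ T then sign R c T • f (T.erase c) else 0

/-- Multiplication by `x c` is null-homotopic on the Koszul complex. -/
lemma differential_wedge (x : ι → R) (c : ι) (f : Finset ι → V) (T : Finset ι) :
    differential x (wedge R c f) T + wedge R c (differential x f) T = x c • f T := by
  by_cases hc : c ∈ T
  · obtain ⟨U, hU, rfl⟩ : ∃ U, c ∉ U ∧ T = insert c U := ⟨T.erase c, by simp, by simp [hc]⟩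
    have hUc : Uᶜ = insert c (insert c U)ᶜ := by
      ext b
      by_cases h : b = c
      · subst h; simp [hU]
      · simp [h]
    rw [wedge, if_pos hc, erase_insert hU]
    simp only [differential_apply]
    rw [hUc, sum_insert (by simp), smul_add, add_left_comm, ← add_assoc, smul_sum]
    have h1 : sign R c (insert c U) • (sign R c U * x c) • f (insert c U)
        = x c • f (insert c U) := by
      rw [sign_insert hU, if_neg (lt_irrefl c), smul_smul, ← mul_assoc, sign_mul_self, one_mul]
    rw [h1, add_assoc, ← sum_add_distrib, add_eq_left]
    refine sum_eq_zero fun b hb => ?_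
    simp only [mem_compl, mem_insert, not_or] at hb
    have h2 : (insert b (insert c U)).erase c = insert b U := by
      rw [insert_comm, erase_insert]; simp [hU, Ne.symm hb.1]
    rw [wedge, if_pos (by simp), h2, smul_smul, smul_smul, ← add_smul]
    convert zero_smul R _
    rw [insert_comm, sign_insert (b := c) (c := c) (by simp [hU, Ne.symm hb.1]),
      sign_insert (b := c) (c := c) hU]
    simp only [lt_irrefl, if_false]
    linear_combination x b * sign_mul_sign_insert (R := R) hb.1 hb.2 hU
  · rw [wedge, if_neg hc, add_zero, differential_apply, sum_eq_single_of_mem c (by simpa using hc)]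
    · rw [wedge, if_pos (by simp), erase_insert hc, smul_smul, sign_insert hc,
        if_neg (lt_irrefl c)]
      congr 1
      linear_combination x c * sign_mul_self (R := R) c T
    · intro b _ hbc
      rw [wedge, if_neg (by simp [hc, Ne.symm hbc]), smul_zero]

lemma differential_mem (x : ι → R) {f : Finset ι → V} {Z : Submodule R V} (hf : ∀ T, f T ∈ Z)
    (T : Finset ι) : differential x f T ∈ Z :=
  Z.sum_mem fun _ _ => Z.smul_mem _ (hf _)

omit [Fintype ι] in
lemma wedge_mem {f : Finset ι → V} {Z : Submodule R V} (hf : ∀ T, f T ∈ Z) (c : ι)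
    (T : Finset ι) : wedge R c f T ∈ Z := by
  unfold wedge
  split_ifs
  exacts [Z.smul_mem _ (hf _), Z.zero_mem]

end Koszul

/-! ### Graded modules over the polynomial ring -/

open MvPolynomial Filter

/-- A grading by `ℕ` of a module over the polynomial ring (with the standard grading), with finite
dimensional pieces. The projections to the pieces are part of the data. -/
structure Grading (K σ V : Type*) [Field K] [AddCommGroup V] [Module K V]
    [Module (MvPolynomial σ K) V] where
  piece : ℕ → Submodule K V
  proj : ℕ → V →ₗ[K] V
  proj_mem : ∀ k v, proj k v ∈ piece k
  proj_of_mem : ∀ {k v}, v ∈ piece k → proj k v = v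
  proj_of_mem_of_ne : ∀ {k l v}, v ∈ piece k → l ≠ k → proj l v = 0
  sum_proj : ∀ v, ∀ᶠ N in atTop, ∑ k ∈ Finset.range N, proj k v = v
  smul_mem : ∀ {p : MvPolynomial σ K} {m k : ℕ} {v : V}, p.IsHomogeneous m → v ∈ piece k →
    p • v ∈ piece (k + m)
  finite : ∀ k, FiniteDimensional K (piece k)

namespace Grading

variable {K σ V W : Type*} [Field K] [AddCommGroup V] [Module K V] [Module (MvPolynomial σ K) V]
  [AddCommGroup W] [Module K W] [Module (MvPolynomial σ K) W]

instance (G : Grading K σ V) (k : ℕ) : FiniteDimensional K (G.piece k) := G.finite k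

/-- A submodule is homogeneous if it contains the components of its elements. -/
def IsHomogeneous (G : Grading K σ V) (Z : Submodule (MvPolynomial σ K) V) : Prop :=
  ∀ v ∈ Z, ∀ k, G.proj k v ∈ Z

/-- A map is graded if it preserves degrees. -/
def IsGradedMap (G : Grading K σ V) (H : Grading K σ W) (φ : V →ₗ[MvPolynomial σ K] W) : Prop :=
  ∀ k, ∀ v ∈ G.piece k, φ v ∈ H.piece k

lemma IsGradedMap.map_proj {G : Grading K σ V} {H : Grading K σ W}
    {φ : V →ₗ[MvPolynomial σ K] W} (hφ : IsGradedMap G H φ) (k : ℕ) (v : V) :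
    φ (G.proj k v) = H.proj k (φ v) := by
  obtain ⟨N, hN, hkN⟩ := ((G.sum_proj v).and (eventually_gt_atTop k)).exists
  conv_rhs => rw [← hN, map_sum, map_sum]
  rw [Finset.sum_eq_single_of_mem k (Finset.mem_range.2 hkN)]
  · exact (H.proj_of_mem (hφ _ _ (G.proj_mem _ _))).symm
  · intro l _ hl
    exact H.proj_of_mem_of_ne (hφ _ _ (G.proj_mem _ _)) hl.symm

lemma IsGradedMap.exists_lift {G : Grading K σ V} {H : Grading K σ W}
    {φ : V →ₗ[MvPolynomial σ K] W} (hφ : IsGradedMap G H φ) {k : ℕ} {w : W}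
    (hw : w ∈ H.piece k) (hw' : w ∈ LinearMap.range φ) : ∃ v ∈ G.piece k, φ v = w := by
  obtain ⟨v, rfl⟩ := hw'
  exact ⟨G.proj k v, G.proj_mem _ _, by rw [hφ.map_proj, H.proj_of_mem hw]⟩

lemma IsGradedMap.isHomogeneous_ker {G : Grading K σ V} {H : Grading K σ W}
    {φ : V →ₗ[MvPolynomial σ K] W} (hφ : IsGradedMap G H φ) :
    G.IsHomogeneous (LinearMap.ker φ) := by
  intro v hv k
  rw [LinearMap.mem_ker] at hv ⊢
  rw [hφ.map_proj, hv, map_zero]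

lemma isHomogeneous_sign [LinearOrder σ] (c : σ) (T : Finset σ) :
    (Koszul.sign (MvPolynomial σ K) c T).IsHomogeneous 0 := by
  simpa [Koszul.sign] using ((isHomogeneous_one σ K).neg).pow _

lemma wedge_mem_piece (G : Grading K σ V) {k : ℕ} [LinearOrder σ] {f : Finset σ → V}
    (hf : ∀ T, f T ∈ G.piece k) (c : σ) (T : Finset σ) :
    Koszul.wedge (MvPolynomial σ K) c f T ∈ G.piece k := by
  unfold Koszul.wedge
  split_ifs
  exacts [G.smul_mem (isHomogeneous_sign c T) (hf _), zero_mem _]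

lemma sub_mem_piece_succ (G : Grading K σ V) {k : ℕ} [LinearOrder σ] [Fintype σ]
    {f g : Finset σ → V} (hf : ∀ T, f T ∈ G.piece (k + 1)) (hg : ∀ T, g T ∈ G.piece k)
    (T : Finset σ) :
    f T - Koszul.differential (X : σ → MvPolynomial σ K) g T ∈ G.piece (k + 1) := by
  refine sub_mem (hf T) (Submodule.sum_mem _ fun c _ => G.smul_mem ?_ (hg _))
  simpa using (isHomogeneous_sign c T).mul (isHomogeneous_X K c)

/-! ### Regularity -/

section Regular

variable [LinearOrder σ] [Fintype σ]

/-- For submodules `B` and `Z` of a graded module: the Koszul complex of the image of `Z` modulo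
`B` is exact at the spots whose coefficients have degree larger than `r`. For homogeneous
`B ≤ Z` this says that the Castelnuovo-Mumford regularity of `Z / B` is at most `r`, as the
Koszul homology is `Tor (Z / B) K`. -/
def IsRegular (G : Grading K σ V) (Z B : Submodule (MvPolynomial σ K) V) (r : ℕ) : Prop :=
  ∀ k ≥ r, ∀ f : Finset σ → V, (∀ T, f T ∈ G.piece (k + 1) ∧ f T ∈ Z) →
    (∀ T, Koszul.differential (X : σ → MvPolynomial σ K) f T ∈ B) →
    ∃ g : Finset σ → V, (∀ T, g T ∈ G.piece k ∧ g T ∈ Z) ∧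
      ∀ T, f T - Koszul.differential (X : σ → MvPolynomial σ K) g T ∈ B

variable {G : Grading K σ V} {A B Z : Submodule (MvPolynomial σ K) V} {r : ℕ}

lemma IsRegular.mono {s : ℕ} (h : G.IsRegular Z B r) (hrs : r ≤ s) : G.IsRegular Z B s :=
  fun k hk => h k (hrs.trans hk)

/-- Regularity of an extension. -/
lemma IsRegular.extension (hAB : A ≤ B) (hBZ : B ≤ Z) (hZ : G.IsRegular Z B r)
    (hB : G.IsRegular B A r) :
    G.IsRegular Z A r := by
  intro k hk f hf hDf
  obtain ⟨g, hg, hfg⟩ := hZ k hk f hf fun T => hAB (hDf T)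
  obtain ⟨h, hh, hfh⟩ := hB k hk (f - Koszul.differential (X : σ → MvPolynomial σ K) g)
    (fun T => ⟨G.sub_mem_piece_succ (fun T => (hf T).1) (fun T => (hg T).1) T, hfg T⟩)
    (fun T => by
      rw [map_sub, Koszul.differential_differential, sub_zero]
      exact hDf T)
  refine ⟨g + h, fun T => ⟨add_mem (hg T).1 (hh T).1, add_mem (hg T).2 (hBZ (hh T).2)⟩,
    fun T => ?_⟩
  rw [map_add, Pi.add_apply, ← sub_sub]
  exact hfh T

/-- Regularity of a submodule, given that of the module and of the quotient. -/
lemma IsRegular.of_quotient (hBZ : B ≤ Z) (hZ : G.IsRegular Z ⊥ (r + 1))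
    (hZB : G.IsRegular Z B r) : G.IsRegular B ⊥ (r + 1) := by
  intro k hk f hf hDf
  obtain ⟨g, hg, hfg⟩ := hZ k hk f (fun T => ⟨(hf T).1, hBZ (hf T).2⟩) hDf
  have hfg' : f = Koszul.differential X g := funext fun T => sub_eq_zero.1 (hfg T)
  obtain ⟨l, rfl⟩ : ∃ l, k = l + 1 := ⟨k - 1, by omega⟩
  obtain ⟨h, hh, hgh⟩ := hZB l (by omega) g hg fun T => hfg' ▸ (hf T).2
  refine ⟨g - Koszul.differential (X : σ → MvPolynomial σ K) h, fun T =>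
    ⟨G.sub_mem_piece_succ (fun T => (hg T).1) (fun T => (hh T).1) T, hgh T⟩, fun T => ?_⟩
  rw [map_sub, Koszul.differential_differential, sub_zero]
  exact hfg T

/-- A module of regularity at most `r` is generated in degrees at most `r`. -/
lemma IsRegular.exists_sum (hZ : G.IsRegular Z ⊥ r) {k : ℕ} (hk : r ≤ k) {v : V}
    (hv : v ∈ G.piece (k + 1)) (hvZ : v ∈ Z) :
    ∃ w : σ → V, (∀ c, w c ∈ G.piece k ∧ w c ∈ Z) ∧
      v = ∑ c, (X c : MvPolynomial σ K) • w c := by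
  obtain ⟨g, hg, hfg⟩ := hZ k hk (fun T => if T = ∅ then v else 0)
    (fun T => by split_ifs; exacts [⟨hv, hvZ⟩, ⟨zero_mem _, zero_mem _⟩])
    (fun T => by simp [Koszul.differential_apply])
  refine ⟨fun c => g {c}, fun c => hg _, ?_⟩
  have := hfg ∅
  simpa [Koszul.differential_apply, sub_eq_zero, Koszul.sign] using this

end Regular

/-! ### Hilbert series -/

section Hilbert

variable [IsScalarTower K (MvPolynomial σ K) V] [IsScalarTower K (MvPolynomial σ K) W]

/-- The Hilbert series of a submodule, with integral coefficients. -/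
noncomputable def hilbertSeries (G : Grading K σ V) (Z : Submodule (MvPolynomial σ K) V) :
    PowerSeries ℤ :=
  PowerSeries.mk fun k => (Module.finrank K ↥(G.piece k ⊓ Z.restrictScalars K) : ℤ)

lemma hilbertSeries_range {G : Grading K σ V} {H : Grading K σ W}
    {φ : V →ₗ[MvPolynomial σ K] W} (hφ : IsGradedMap G H φ) :
    H.hilbertSeries (LinearMap.range φ) =
      G.hilbertSeries ⊤ - G.hilbertSeries (LinearMap.ker φ) := by
  ext k
  simp only [hilbertSeries, PowerSeries.coeff_mk, map_sub]
  rw [eq_sub_iff_add_eq]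
  have h := LinearMap.finrank_range_add_finrank_ker ((φ.restrictScalars K).domRestrict (G.piece k))
  have h1 : LinearMap.range ((φ.restrictScalars K).domRestrict (G.piece k)) =
      H.piece k ⊓ (LinearMap.range φ).restrictScalars K := by
    ext w
    constructor
    · rintro ⟨v, rfl⟩
      exact ⟨hφ _ _ v.2, v.1, rfl⟩
    · rintro ⟨hw, hw'⟩
      obtain ⟨v, hv, rfl⟩ := hφ.exists_lift hw hw'
      exact ⟨⟨v, hv⟩, rfl⟩
  have h2 : (LinearMap.ker ((φ.restrictScalars K).domRestrict (G.piece k))).map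
      (G.piece k).subtype = G.piece k ⊓ (LinearMap.ker φ).restrictScalars K := by
    ext v
    simp only [Submodule.mem_map, LinearMap.mem_ker, Submodule.mem_inf,
      Submodule.restrictScalars_mem, Submodule.subtype_apply]
    constructor
    · rintro ⟨v, hv, rfl⟩
      exact ⟨v.2, hv⟩
    · rintro ⟨hv, hv'⟩
      exact ⟨⟨v, hv⟩, hv', rfl⟩
  rw [h1] at h
  rw [← h2, Submodule.finrank_map_subtype_eq, Submodule.restrictScalars_top, inf_top_eq]
  exact_mod_cast h

end Hilbert

/-! ### Graded free modules -/

/-- The polynomial ring with its grading shifted so that `1` has degree `a`. -/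
noncomputable def shifted (K σ : Type*) [Field K] [Finite σ] (a : ℕ) :
    Grading K σ (MvPolynomial σ K) where
  piece k := if a ≤ k then homogeneousSubmodule σ K (k - a) else ⊥
  proj k := if a ≤ k then homogeneousComponent (k - a) else 0
  proj_mem k v := by
    split_ifs
    exacts [homogeneousComponent_mem _ _, zero_mem _]
  proj_of_mem {k v} hv := by
    split_ifs at hv ⊢ with h
    · exact homogeneousComponent_eq_self hv
    · simp_all
  proj_of_mem_of_ne {k l v} hv hl := by
    split_ifs at hv ⊢ with h h'
    · rw [homogeneousComponent_of_mem hv, if_neg (by omega)]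
    · rw [(Submodule.mem_bot K).1 hv, map_zero]
    all_goals rfl
  sum_proj v := by
    filter_upwards [eventually_ge_atTop (a + (v.totalDegree + 1))] with N hN
    obtain ⟨M, rfl⟩ := Nat.exists_eq_add_of_le hN
    rw [add_assoc, Finset.sum_range_add, Finset.sum_range_add, Finset.sum_eq_zero, zero_add]
    · conv_rhs => rw [← sum_homogeneousComponent v]
      rw [Finset.sum_eq_zero (s := Finset.range M), add_zero]
      · refine Finset.sum_congr rfl fun k _ => ?_
        simp
      · intro k _
        rw [if_pos (by omega)]
        exact homogeneousComponent_eq_zero _ _ (by omega)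
    · intro k hk
      rw [if_neg (by simpa using hk)]
      rfl
  smul_mem {p m k v} hp hv := by
    by_cases h : a ≤ k
    · rw [if_pos h] at hv
      rw [if_pos (h.trans (Nat.le_add_right k m)), Nat.sub_add_comm h, smul_eq_mul, mul_comm]
      exact IsHomogeneous.mul hv hp
    · rw [if_neg h, Submodule.mem_bot] at hv
      rw [hv, smul_zero]
      exact zero_mem _
  finite k := by
    by_cases h : a ≤ k
    · rw [if_pos h]
      exact Module.Finite.iff_fg.2 (homogeneousSubmodule_fg _ _ _)
    · rw [if_neg h]
      infer_instance

/-- The standard grading of the polynomial ring. -/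
noncomputable abbrev standard (K σ : Type*) [Field K] [Finite σ] :
    Grading K σ (MvPolynomial σ K) := shifted K σ 0

lemma mem_shifted_piece [Finite σ] {a k : ℕ} {p : MvPolynomial σ K} :
    p ∈ (shifted K σ a).piece k ↔ p = 0 ∨ ∃ m, k = a + m ∧ p.IsHomogeneous m := by
  simp only [shifted]
  split_ifs with h
  · rw [mem_homogeneousSubmodule]
    constructor
    · exact fun hp => Or.inr ⟨k - a, by omega, hp⟩
    · rintro (rfl | ⟨m, rfl, hp⟩)
      · exact isHomogeneous_zero _ _ _
      · simpa using hp
  · rw [Submodule.mem_bot]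
    constructor
    · exact Or.inl
    · rintro (hp | ⟨m, rfl, _⟩)
      · exact hp
      · omega

@[simp]
lemma mem_standard_piece [Finite σ] {k : ℕ} {p : MvPolynomial σ K} :
    p ∈ (standard K σ).piece k ↔ p.IsHomogeneous k := by
  simp [standard, shifted]

lemma standard_proj [Finite σ] (k : ℕ) (p : MvPolynomial σ K) :
    (standard K σ).proj k p = homogeneousComponent k p := by
  simp [standard, shifted]

/-- The direct sum of finitely many graded modules. -/
def pi {ι : Type*} [Finite ι] (G : ι → Grading K σ V) : Grading K σ (ι → V) where
  piece k := Submodule.pi Set.univ fun j => (G j).piece k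
  proj k := LinearMap.pi fun j => (G j).proj k ∘ₗ LinearMap.proj j
  proj_mem k v := fun j _ => (G j).proj_mem k _
  proj_of_mem hv := funext fun j => (G j).proj_of_mem (hv j trivial)
  proj_of_mem_of_ne hv hl := funext fun j => (G j).proj_of_mem_of_ne (hv j trivial) hl
  sum_proj v := by
    filter_upwards [eventually_all.2 fun j => (G j).sum_proj (v j)] with N hN
    ext j
    simpa using hN j
  smul_mem hp hv := fun j _ => (G j).smul_mem hp (hv j trivial)
  finite k := by
    have := Fintype.ofFinite ι
    refine Module.Finite.of_injective
      (LinearMap.pi fun j => ((LinearMap.proj j).comp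
        (Submodule.subtype _)).codRestrict ((G j).piece k) fun v => v.2 j trivial)
      fun v w h => Subtype.ext (_root_.funext fun j => ?_)
    exact congrArg (fun u : ι → V => u j)
      (congrArg (fun (u : ∀ j, (G j).piece k) j => (u j : V)) h)

/-- The graded free module with basis elements of degrees `deg j`. -/
noncomputable abbrev free (K σ : Type*) [Field K] [Finite σ] {ι : Type*} [Finite ι] (deg : ι → ℕ) :
    Grading K σ (ι → MvPolynomial σ K) := pi fun j => shifted K σ (deg j)

lemma mem_free_piece [Finite σ] {ι : Type*} [Finite ι] {deg : ι → ℕ} {k : ℕ}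
    {v : ι → MvPolynomial σ K} :
    v ∈ (free K σ deg).piece k ↔ ∀ j, v j = 0 ∨ ∃ m, k = deg j + m ∧ (v j).IsHomogeneous m := by
  simp [free, pi, Submodule.mem_pi, mem_shifted_piece]

end Grading

/-! ### Squarefree monomial ideals -/

/-- The ideal generated by the squarefree monomials with supports in `𝓕`. -/
noncomputable def squarefreeIdeal (K : Type*) {σ : Type*} [Field K] (𝓕 : Set (Finset σ)) :
    Ideal (MvPolynomial σ K) :=
  Ideal.span ((fun F : Finset σ => ∏ j ∈ F, X j) '' 𝓕)

/-- The ideal generated by the variables with index in `A`. -/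
noncomputable abbrev variableIdeal (K : Type*) {σ : Type*} [Field K] (A : Finset σ) :
    Ideal (MvPolynomial σ K) :=
  squarefreeIdeal K (singleton '' (A : Set σ))

section SquarefreeIdeal

variable {K σ : Type*} [Field K]

lemma prod_X_eq_monomial (F : Finset σ) :
    ∏ j ∈ F, (X j : MvPolynomial σ K) = monomial (∑ j ∈ F, Finsupp.single j 1) 1 := by
  rw [monomial_sum_one]
  rfl

lemma isHomogeneous_prod_X (F : Finset σ) :
    (∏ j ∈ F, (X j : MvPolynomial σ K)).IsHomogeneous F.card := by
  have := IsHomogeneous.prod F (fun j => (X j : MvPolynomial σ K)) (fun _ => 1)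
    fun j _ => isHomogeneous_X K j
  simpa using this

lemma sum_single_apply [DecidableEq σ] (F : Finset σ) (i : σ) :
    (∑ j ∈ F, Finsupp.single j 1 : σ →₀ ℕ) i = if i ∈ F then 1 else 0 := by
  simp [Finsupp.finsetSum_apply, Finsupp.single_apply]

lemma sum_single_le_iff (F : Finset σ) (s : σ →₀ ℕ) :
    (∑ j ∈ F, Finsupp.single j 1 : σ →₀ ℕ) ≤ s ↔ F ⊆ s.support := by
  classical
  rw [Finsupp.le_def]
  constructor
  · intro h i hi
    have := h i
    rw [sum_single_apply, if_pos hi] at this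
    rw [Finsupp.mem_support_iff]
    omega
  · intro h i
    rw [sum_single_apply]
    split_ifs with hi
    · exact Nat.one_le_iff_ne_zero.2 (Finsupp.mem_support_iff.1 (h hi))
    · exact Nat.zero_le _

lemma mem_squarefreeIdeal {𝓕 : Set (Finset σ)} {p : MvPolynomial σ K} :
    p ∈ squarefreeIdeal K 𝓕 ↔ ∀ s ∈ p.support, ∃ F ∈ 𝓕, F ⊆ s.support := by
  have : (fun F : Finset σ => ∏ j ∈ F, (X j : MvPolynomial σ K)) '' 𝓕 =
      (fun s => monomial s (1 : K)) '' ((fun F => ∑ j ∈ F, Finsupp.single j 1) '' 𝓕) := by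
    rw [Set.image_image]
    exact congrArg (· '' 𝓕) (_root_.funext prod_X_eq_monomial)
  rw [squarefreeIdeal, this, mem_ideal_span_monomial_image]
  simp only [Set.exists_mem_image, sum_single_le_iff]

lemma squarefreeIdeal_le {𝓕 𝓖 : Set (Finset σ)} (h : ∀ F ∈ 𝓕, ∃ G ∈ 𝓖, G ⊆ F) :
    squarefreeIdeal K 𝓕 ≤ squarefreeIdeal K 𝓖 := by
  intro p hp
  rw [mem_squarefreeIdeal] at hp ⊢
  intro s hs
  obtain ⟨F, hF, hFs⟩ := hp s hs
  obtain ⟨G, hG, hGF⟩ := h F hF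
  exact ⟨G, hG, hGF.trans hFs⟩

lemma squarefreeIdeal_empty : squarefreeIdeal K (∅ : Set (Finset σ)) = ⊥ := by
  simp [squarefreeIdeal]

lemma variableIdeal_empty : variableIdeal K (∅ : Finset σ) = ⊥ := by
  rw [variableIdeal, Finset.coe_empty, Set.image_empty, squarefreeIdeal_empty]

lemma mem_variableIdeal {A : Finset σ} {p : MvPolynomial σ K} :
    p ∈ variableIdeal K A ↔ ∀ s ∈ p.support, ∃ c ∈ A, c ∈ s.support := by
  rw [mem_squarefreeIdeal]
  simp

lemma mem_variableIdeal_univ [Fintype σ] {p : MvPolynomial σ K} {k : ℕ}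
    (hp : p.IsHomogeneous (k + 1)) : p ∈ variableIdeal K (Finset.univ : Finset σ) := by
  rw [mem_variableIdeal]
  intro s hs
  have h0 : s ≠ 0 := by
    rintro rfl
    have := hp.degree_eq_sum_deg_support hs
    simp at this
  obtain ⟨c, hc⟩ := Finsupp.support_nonempty_iff.2 h0
  exact ⟨c, Finset.mem_univ _, hc⟩

lemma isHomogeneous_squarefreeIdeal [Finite σ] (𝓕 : Set (Finset σ)) :
    (Grading.standard K σ).IsHomogeneous (squarefreeIdeal K 𝓕) := by
  intro p hp k
  rw [Grading.standard_proj]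
  rw [mem_squarefreeIdeal] at hp ⊢
  intro s hs
  rw [support_homogeneousComponent] at hs
  exact hp s (Finset.mem_filter.1 hs).1

/-- Sufficient conditions for the colon ideal of `squarefreeIdeal K 𝓕` by the monomial with support
`e` to be generated by the variables with index in `A`. -/
structure IsColonStep [DecidableEq σ] (𝓕 : Set (Finset σ)) (e A : Finset σ) : Prop where
  exists_mem : ∀ F ∈ 𝓕, ∃ c ∈ A, c ∈ F ∧ c ∉ e
  exists_subset : ∀ c ∈ A, ∃ F ∈ 𝓕, F ⊆ insert c e

variable [DecidableEq σ] {𝓕 : Set (Finset σ)} {e A : Finset σ}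

lemma IsColonStep.mul_mem_iff (h : IsColonStep 𝓕 e A) {p : MvPolynomial σ K} :
    p * ∏ j ∈ e, X j ∈ squarefreeIdeal K 𝓕 ↔ p ∈ variableIdeal K A := by
  rw [mem_squarefreeIdeal, mem_variableIdeal, prod_X_eq_monomial]
  have hsup (s : σ →₀ ℕ) : (s + ∑ j ∈ e, Finsupp.single j 1).support = s.support ∪ e := by
    ext i
    simp only [Finsupp.mem_support_iff, Finsupp.add_apply, sum_single_apply, Finset.mem_union]
    split_ifs with hi <;> simp [hi]
  constructor
  · intro hp s hs
    obtain ⟨F, hF, hFs⟩ := hp (s + ∑ j ∈ e, Finsupp.single j 1) (by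
      rw [mem_support_iff, coeff_mul_monomial, mul_one]
      exact mem_support_iff.1 hs)
    obtain ⟨c, hcA, hcF, hce⟩ := h.exists_mem F hF
    rw [hsup] at hFs
    exact ⟨c, hcA, (Finset.mem_union.1 (hFs hcF)).resolve_right hce⟩
  · intro hp s hs
    rw [mem_support_iff, coeff_mul_monomial', ite_ne_right_iff, mul_one] at hs
    obtain ⟨t, rfl⟩ := exists_add_of_le hs.1
    obtain ⟨c, hcA, hct⟩ := hp t (by simpa using hs.2)
    obtain ⟨F, hF, hFe⟩ := h.exists_subset c hcA
    refine ⟨F, hF, hFe.trans ?_⟩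
    rw [add_comm, hsup]
    exact Finset.insert_subset (Finset.mem_union_left _ hct) Finset.subset_union_right

lemma isColonStep_singleton {A : Finset σ} {c : σ} (hc : c ∉ A) :
    IsColonStep (singleton '' (A : Set σ)) {c} A where
  exists_mem := by
    rintro _ ⟨b, hb, rfl⟩
    refine ⟨b, hb, Finset.mem_singleton_self b, fun h => hc ?_⟩
    rwa [← Finset.mem_singleton.1 h]
  exists_subset b hb := ⟨{b}, ⟨b, hb, rfl⟩, by simp⟩

omit [DecidableEq σ] in
lemma squarefreeIdeal_le_insert : squarefreeIdeal K 𝓕 ≤ squarefreeIdeal K (insert e 𝓕) :=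
  squarefreeIdeal_le fun F hF => ⟨F, Set.mem_insert_of_mem _ hF, subset_rfl⟩

/-- Multiplication by a squarefree monomial. -/
noncomputable def mulProd (K : Type*) [Field K] (e : Finset σ) :
    MvPolynomial σ K →ₗ[MvPolynomial σ K] MvPolynomial σ K :=
  LinearMap.toSpanSingleton _ _ (∏ j ∈ e, X j)

omit [DecidableEq σ] in
lemma mulProd_apply (e : Finset σ) (p : MvPolynomial σ K) :
    mulProd K e p = p * ∏ j ∈ e, X j := rfl

omit [DecidableEq σ] in
lemma mulProd_injective (e : Finset σ) : Function.Injective (mulProd K e) := fun _ _ h =>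
  mul_right_cancel₀ (Finset.prod_ne_zero_iff.2 fun j _ => X_ne_zero j) h

omit [DecidableEq σ] in
lemma isGradedMap_mulProd [Finite σ] (e : Finset σ) :
    Grading.IsGradedMap (Grading.shifted K σ e.card) (Grading.standard K σ) (mulProd K e) := by
  intro k p hp
  rw [Grading.mem_standard_piece, mulProd_apply]
  rcases Grading.mem_shifted_piece.1 hp with rfl | ⟨m, rfl, hp'⟩
  · rw [zero_mul]
    exact isHomogeneous_zero _ _ _
  · rw [mul_comm]
    exact (isHomogeneous_prod_X e).mul hp'

omit [DecidableEq σ] in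
lemma mulProd_mem_insert (p : MvPolynomial σ K) :
    mulProd K e p ∈ squarefreeIdeal K (insert e 𝓕) :=
  Ideal.mul_mem_left _ _ (Ideal.subset_span ⟨e, Set.mem_insert _ _, rfl⟩)

omit [DecidableEq σ] in
lemma exists_sub_mulProd_mem [Finite σ] {p : MvPolynomial σ K} {k : ℕ} (hp : p.IsHomogeneous k)
    (hpe : p ∈ squarefreeIdeal K (insert e 𝓕)) :
    ∃ h ∈ (Grading.shifted K σ e.card).piece k, p - mulProd K e h ∈ squarefreeIdeal K 𝓕 := by
  rw [squarefreeIdeal, Set.image_insert_eq, Ideal.mem_span_insert] at hpe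
  obtain ⟨a, z, hz, rfl⟩ := hpe
  refine ⟨_, (Grading.shifted K σ e.card).proj_mem k a, ?_⟩
  rw [(isGradedMap_mulProd e).map_proj]
  have := (Grading.standard K σ).proj_of_mem (Grading.mem_standard_piece.2 hp)
  rw [← this, ← map_sub, mulProd_apply, add_sub_cancel_left]
  exact isHomogeneous_squarefreeIdeal 𝓕 _ hz _

end SquarefreeIdeal

/-! ### Regularity and Hilbert series in a colon step -/

section ColonStep

variable {K σ : Type*} [Field K] [LinearOrder σ] [Fintype σ] {𝓕 : Set (Finset σ)}
  {e A : Finset σ}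

lemma isRegular_variableIdeal (A : Finset σ) :
    (Grading.standard K σ).IsRegular ⊤ (variableIdeal K A) 0 := by
  obtain ⟨B, rfl⟩ : ∃ B, A = Bᶜ := ⟨Aᶜ, by simp⟩
  induction B using Finset.induction_on with
  | empty =>
    intro k _ f hf _
    refine ⟨0, fun T => ⟨zero_mem _, zero_mem _⟩, fun T => ?_⟩
    rw [map_zero, Pi.zero_apply, sub_zero, Finset.compl_empty]
    exact mem_variableIdeal_univ (Grading.mem_standard_piece.1 (hf T).1)
  | insert c B hcB ih =>
    intro k hk f hf hDf
    have hB : Bᶜ = insert c (insert c B)ᶜ := by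
      ext b
      by_cases h : b = c
      · subst h; simp [hcB]
      · simp [h]
    have hc : c ∉ (insert c B)ᶜ := by simp
    generalize (insert c B)ᶜ = A at *
    have hcA := isColonStep_singleton hc
    rw [hB, variableIdeal, Finset.coe_insert, Set.image_insert_eq] at ih
    obtain ⟨g, hg, hfg⟩ := ih k hk f hf fun T => squarefreeIdeal_le_insert (hDf T)
    have hfg' := Grading.sub_mem_piece_succ (Grading.standard K σ) (fun T => (hf T).1)
      (fun T => (hg T).1)
    choose h hh hfh using fun T =>
      exists_sub_mulProd_mem (Grading.mem_standard_piece.1 (hfg' T)) (hfg T)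
    -- `f` is congruent to `D g + x_c h` modulo the variables in `A`, and `x_c` is a nonzerodivisor
    -- modulo these, so `h` is again a cycle and `x_c h` a boundary.
    have hDh (T) : Koszul.differential (X : σ → MvPolynomial σ K) h T ∈ variableIdeal K A := by
      rw [← hcA.mul_mem_iff, ← mulProd_apply, Koszul.map_differential]
      have := sub_mem (hDf T)
        (Koszul.differential_mem (X : σ → MvPolynomial σ K) hfh T)
      convert this using 1
      have h1 : (fun T => mulProd K {c} (h T)) =
          f - Koszul.differential (X : σ → MvPolynomial σ K) g -
          fun T => f T - Koszul.differential (X : σ → MvPolynomial σ K) g T -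
            mulProd K {c} (h T) :=
        _root_.funext fun T => (sub_sub_cancel _ _).symm
      rw [h1, map_sub, map_sub, Koszul.differential_differential, sub_zero]
      rfl
    have hhk (T) : h T ∈ (Grading.standard K σ).piece k := by
      rw [Grading.mem_standard_piece]
      rcases Grading.mem_shifted_piece.1 (hh T) with h | ⟨m, hm, h⟩
      · rw [h]
        exact isHomogeneous_zero _ _ _
      · rw [Finset.card_singleton] at hm
        convert h
        omega
    refine ⟨g + Koszul.wedge (MvPolynomial σ K) c h, fun T =>
      ⟨add_mem (hg T).1 (Grading.wedge_mem_piece _ hhk c T), trivial⟩, fun T => ?_⟩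
    have := add_mem (hfh T) (Koszul.wedge_mem (R := MvPolynomial σ K) hDh c T)
    convert this using 1
    have h2 := Koszul.differential_wedge (X : σ → MvPolynomial σ K) c h T
    rw [map_add, Pi.add_apply, mulProd_apply, Finset.prod_singleton, mul_comm (h T),
      ← smul_eq_mul (X c), ← h2]
    ring

lemma IsColonStep.isRegular (h : IsColonStep 𝓕 e A) :
    (Grading.standard K σ).IsRegular (squarefreeIdeal K (insert e 𝓕)) (squarefreeIdeal K 𝓕)
      e.card := by
  intro k hk f hf hDf
  choose p hp hfp using fun T =>
    exists_sub_mulProd_mem (Grading.mem_standard_piece.1 (hf T).1) (hf T).2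
  obtain ⟨l, rfl⟩ := Nat.exists_eq_add_of_le hk
  have hp' (T) : (p T).IsHomogeneous (l + 1) := by
    rcases Grading.mem_shifted_piece.1 (hp T) with h | ⟨m, hm, h⟩
    · rw [h]
      exact isHomogeneous_zero _ _ _
    · convert h
      omega
  have hDp (T) : Koszul.differential (X : σ → MvPolynomial σ K) p T ∈ variableIdeal K A := by
    rw [← h.mul_mem_iff, ← mulProd_apply, Koszul.map_differential]
    have h1 : (fun T => mulProd K e (p T)) = f - fun T => f T - mulProd K e (p T) :=
      _root_.funext fun T => (sub_sub_cancel _ _).symm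
    rw [h1, map_sub]
    exact sub_mem (hDf T) (Koszul.differential_mem (X : σ → MvPolynomial σ K) hfp T)
  obtain ⟨g, hg, hpg⟩ := isRegular_variableIdeal A l (Nat.zero_le _) p
    (fun T => ⟨Grading.mem_standard_piece.2 (hp' T), trivial⟩) hDp
  have hgl (T) : g T ∈ (Grading.shifted K σ e.card).piece (e.card + l) :=
    Grading.mem_shifted_piece.2 (Or.inr ⟨l, rfl, Grading.mem_standard_piece.1 (hg T).1⟩)
  refine ⟨fun T => mulProd K e (g T), fun T => ⟨isGradedMap_mulProd e _ _ (hgl T),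
    mulProd_mem_insert _⟩, fun T => ?_⟩
  have := add_mem (hfp T) (h.mul_mem_iff.2 (hpg T))
  rw [← mulProd_apply, map_sub, Koszul.map_differential, sub_add_sub_cancel] at this
  exact this

omit [LinearOrder σ] in
lemma hilbertSeries_shifted (a : ℕ) (Z : Ideal (MvPolynomial σ K)) :
    (Grading.shifted K σ a).hilbertSeries Z =
      PowerSeries.X ^ a * (Grading.standard K σ).hilbertSeries Z := by
  ext k
  rw [PowerSeries.coeff_X_pow_mul']
  simp only [Grading.hilbertSeries, PowerSeries.coeff_mk]
  split_ifs with h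
  · have : (Grading.shifted K σ a).piece k = (Grading.standard K σ).piece (k - a) := by
      simp [Grading.shifted, h]
    rw [this]
  · have : (Grading.shifted K σ a).piece k = ⊥ := by
      simp [Grading.shifted, h]
    rw [this, bot_inf_eq, finrank_bot, Nat.cast_zero]

lemma IsColonStep.hilbertSeries (h : IsColonStep 𝓕 e A) :
    (Grading.standard K σ).hilbertSeries (squarefreeIdeal K (insert e 𝓕)) =
      (Grading.standard K σ).hilbertSeries (squarefreeIdeal K 𝓕) + PowerSeries.X ^ e.card *
      ((Grading.standard K σ).hilbertSeries ⊤ -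
        (Grading.standard K σ).hilbertSeries (variableIdeal K A)) := by
  rw [mul_sub, ← hilbertSeries_shifted, ← hilbertSeries_shifted, ← add_sub_assoc,
    eq_sub_iff_add_eq]
  ext k
  simp only [Grading.hilbertSeries, PowerSeries.coeff_mk, map_add, Submodule.restrictScalars_top]
  set P := (Grading.standard K σ).piece k
  set Q := (Grading.shifted K σ e.card).piece k
  have hinj := mulProd_injective (K := K) e
  have hsup : P ⊓ (squarefreeIdeal K (insert e 𝓕)).restrictScalars K =
      (P ⊓ (squarefreeIdeal K 𝓕).restrictScalars K) ⊔
        (Q ⊓ ⊤).map ((mulProd K e).restrictScalars K) := by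
    apply le_antisymm
    · rintro p ⟨hp, hp'⟩
      obtain ⟨q, hq, hpq⟩ := exists_sub_mulProd_mem (Grading.mem_standard_piece.1 hp) hp'
      rw [← sub_add_cancel p (mulProd K e q)]
      exact Submodule.add_mem_sup ⟨sub_mem hp (isGradedMap_mulProd e _ _ hq), hpq⟩
        ⟨q, ⟨hq, trivial⟩, rfl⟩
    · refine sup_le (inf_le_inf le_rfl fun p hp => squarefreeIdeal_le_insert hp) ?_
      rintro _ ⟨q, hq, rfl⟩
      exact ⟨isGradedMap_mulProd e _ _ hq.1, mulProd_mem_insert q⟩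
  have hinf : (P ⊓ (squarefreeIdeal K 𝓕).restrictScalars K) ⊓
      (Q ⊓ ⊤).map ((mulProd K e).restrictScalars K) =
        (Q ⊓ (variableIdeal K A).restrictScalars K).map ((mulProd K e).restrictScalars K) := by
    ext p
    constructor
    · rintro ⟨hp, q, hq, rfl⟩
      exact ⟨q, ⟨hq.1, h.mul_mem_iff.1 hp.2⟩, rfl⟩
    · rintro ⟨q, hq, rfl⟩
      exact ⟨⟨isGradedMap_mulProd e _ _ hq.1, h.mul_mem_iff.2 hq.2⟩, q, ⟨hq.1, trivial⟩, rfl⟩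
  have := Submodule.finrank_sup_add_finrank_inf_eq
    (P ⊓ (squarefreeIdeal K 𝓕).restrictScalars K)
    ((Q ⊓ ⊤).map ((mulProd K e).restrictScalars K))
  have hfr (R : Submodule K (MvPolynomial σ K)) :
      Module.finrank K ↥(R.map ((mulProd K e).restrictScalars K)) = Module.finrank K R :=
    (R.equivMapOfInjective ((mulProd K e).restrictScalars K) hinj).symm.finrank_eq
  rw [← hsup, hinf, hfr, hfr] at this
  exact_mod_cast this

end ColonStep

/-! ### Numerators of Hilbert series -/

/-- The numerator `(1 - X)^n * H(S / I)` of the Hilbert series of the quotient of the polynomial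
ring `S` in `n` variables by the ideal `I`. -/
noncomputable def numerator (K : Type*) {σ : Type*} [Field K] [Fintype σ]
    (I : Ideal (MvPolynomial σ K)) : PowerSeries ℤ :=
  (1 - PowerSeries.X) ^ Fintype.card σ *
    ((Grading.standard K σ).hilbertSeries ⊤ - (Grading.standard K σ).hilbertSeries I)

section Numerator

variable {K σ : Type*} [Field K] [LinearOrder σ] [Fintype σ] {𝓕 : Set (Finset σ)}
  {e A : Finset σ}

omit [LinearOrder σ] in
lemma hilbertSeries_bot : (Grading.standard K σ).hilbertSeries ⊥ = 0 := by
  ext k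
  have : (Grading.standard K σ).piece k ⊓
      (⊥ : Ideal (MvPolynomial σ K)).restrictScalars K = ⊥ :=
    eq_bot_iff.2 fun p hp => hp.2
  rw [Grading.hilbertSeries, PowerSeries.coeff_mk, this, finrank_bot, Nat.cast_zero, map_zero]

omit [LinearOrder σ] in
lemma coeff_hilbertSeries_top (k : ℕ) :
    PowerSeries.coeff k ((Grading.standard K σ).hilbertSeries ⊤) =
      Module.finrank K ((Grading.standard K σ).piece k) := by
  have : (Grading.standard K σ).piece k ⊓
      (⊤ : Ideal (MvPolynomial σ K)).restrictScalars K = (Grading.standard K σ).piece k :=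
    inf_eq_left.2 fun _ _ => trivial
  rw [Grading.hilbertSeries, PowerSeries.coeff_mk, this]

omit [LinearOrder σ] in
lemma hilbertSeries_top_sub_univ :
    (Grading.standard K σ).hilbertSeries ⊤ -
      (Grading.standard K σ).hilbertSeries (variableIdeal K Finset.univ) = 1 := by
  ext k
  rw [map_sub, coeff_hilbertSeries_top, Grading.hilbertSeries, PowerSeries.coeff_mk,
    PowerSeries.coeff_one]
  split_ifs with hk
  · subst hk
    have h0 : (Grading.standard K σ).piece 0 = 1 := by
      ext p
      rw [Grading.mem_standard_piece, ← homogeneousSubmodule_zero, mem_homogeneousSubmodule]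
    have h1 : (Grading.standard K σ).piece 0 ⊓
        (variableIdeal K (Finset.univ : Finset σ)).restrictScalars K = ⊥ := by
      rw [eq_bot_iff]
      rintro p ⟨hp, hp'⟩
      rw [Submodule.mem_bot]
      rw [SetLike.mem_coe, Submodule.restrictScalars_mem, mem_variableIdeal] at hp'
      rw [SetLike.mem_coe, Grading.mem_standard_piece] at hp
      rw [← support_eq_empty, Finset.eq_empty_iff_forall_notMem]
      intro s hs
      have h2 := hp.degree_eq_sum_deg_support hs
      obtain ⟨c, -, hc⟩ := hp' s hs
      have h3 := Finsupp.mem_support_iff.1 hc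
      have h4 : s c ≤ ∑ i ∈ s.support, s i :=
        Finset.single_le_sum (fun i _ => Nat.zero_le (s i)) hc
      omega
    have h2 : Module.finrank K ↥(1 : Submodule K (MvPolynomial σ K)) = 1 := by
      rw [Submodule.one_eq_span]
      exact finrank_span_singleton one_ne_zero
    rw [h1, h0, finrank_bot, h2]
    simp
  · obtain ⟨l, rfl⟩ := Nat.exists_eq_succ_of_ne_zero hk
    have : (Grading.standard K σ).piece (l + 1) ⊓
        (variableIdeal K (Finset.univ : Finset σ)).restrictScalars K =
          (Grading.standard K σ).piece (l + 1) :=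
      inf_eq_left.2 fun p hp => mem_variableIdeal_univ (Grading.mem_standard_piece.1 hp)
    rw [Nat.succ_eq_add_one, this, sub_self]

lemma hilbertSeries_variableIdeal (A : Finset σ) :
    (Grading.standard K σ).hilbertSeries ⊤ -
      (Grading.standard K σ).hilbertSeries (variableIdeal K A) =
    (1 - PowerSeries.X) ^ A.card * (Grading.standard K σ).hilbertSeries ⊤ := by
  induction A using Finset.induction_on with
  | empty =>
    rw [variableIdeal_empty, hilbertSeries_bot]
    simp
  | insert c A hc ih =>
    rw [variableIdeal, Finset.coe_insert, Set.image_insert_eq,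
      (isColonStep_singleton hc).hilbertSeries, Finset.card_insert_of_notMem hc, ih,
      ← sub_sub, ih, Finset.card_singleton]
    ring

lemma one_sub_X_pow_mul_hilbertSeries_top :
    (1 - PowerSeries.X) ^ Fintype.card σ * (Grading.standard K σ).hilbertSeries ⊤ = 1 := by
  rw [← Finset.card_univ, ← hilbertSeries_variableIdeal, hilbertSeries_top_sub_univ]

lemma numerator_eq (I : Ideal (MvPolynomial σ K)) :
    numerator K I = 1 - (1 - PowerSeries.X) ^ Fintype.card σ *
      (Grading.standard K σ).hilbertSeries I := by
  rw [numerator, mul_sub, one_sub_X_pow_mul_hilbertSeries_top]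

lemma IsColonStep.numerator (h : IsColonStep 𝓕 e A) :
    numerator K (squarefreeIdeal K 𝓕) = numerator K (squarefreeIdeal K (insert e 𝓕)) +
      PowerSeries.X ^ e.card * (1 - PowerSeries.X) ^ A.card := by
  rw [numerator_eq, numerator_eq, h.hilbertSeries, hilbertSeries_variableIdeal]
  linear_combination PowerSeries.X ^ e.card * (1 - PowerSeries.X) ^ A.card *
    one_sub_X_pow_mul_hilbertSeries_top (K := K) (σ := σ)

/-! ### The ideal of all squarefree monomials of a given degree -/

omit [LinearOrder σ] [Fintype σ] in
lemma squarefreeIdeal_union_card (d : ℕ) :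
    squarefreeIdeal K ({F | F.card = d + 1} ∪ {F | F.card = d}) =
      squarefreeIdeal K ({F | F.card = d} : Set (Finset σ)) := by
  apply le_antisymm <;> apply squarefreeIdeal_le
  · rintro F (hF | hF)
    · obtain ⟨G, hGF, hG⟩ := Finset.exists_subset_card_eq (s := F) (n := d) (by
        rw [Set.mem_ofPred_eq] at hF
        omega)
      exact ⟨G, hG, hGF⟩
    · exact ⟨F, hF, subset_rfl⟩
  · exact fun F hF => ⟨F, Or.inr hF, subset_rfl⟩

lemma isColonStep_union {d : ℕ} {E : Finset (Finset σ)} (hE : ∀ F ∈ E, F.card = d)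
    (he : e.card = d) (heE : e ∉ E) :
    IsColonStep ({F | F.card = d + 1} ∪ (E : Set (Finset σ))) e eᶜ where
  exists_mem F hF := by
    have : ¬F ⊆ e := by
      intro hFe
      rcases hF with hF | hF
      · have := Finset.card_le_card hFe
        rw [Set.mem_ofPred_eq] at hF
        omega
      · have := Finset.eq_of_subset_of_card_le hFe (by rw [he, hE F hF])
        exact heE (this ▸ hF)
    obtain ⟨c, hcF, hce⟩ := Finset.not_subset.1 this
    exact ⟨c, Finset.mem_compl.2 hce, hcF, hce⟩
  exists_subset c hc := by
    refine ⟨insert c e, Or.inl ?_, subset_rfl⟩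
    rw [Set.mem_ofPred_eq, Finset.card_insert_of_notMem (Finset.mem_compl.1 hc), he]

lemma isRegular_of_isRegular_union {d : ℕ} (E : Finset (Finset σ)) (hE : ∀ F ∈ E, F.card = d)
    (h : (Grading.standard K σ).IsRegular (squarefreeIdeal K ({F | F.card = d + 1} ∪ E)) ⊥
      (d + 1)) :
    (Grading.standard K σ).IsRegular (squarefreeIdeal K {F | F.card = d + 1}) ⊥ (d + 1) := by
  induction E using Finset.induction_on with
  | empty => simpa using h
  | insert e E heE ih =>
    have he : e.card = d := hE e (Finset.mem_insert_self e E)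
    have hE' : ∀ F ∈ E, F.card = d := fun F hF => hE F (Finset.mem_insert_of_mem hF)
    refine ih hE' (Grading.IsRegular.of_quotient squarefreeIdeal_le_insert ?_
      (he ▸ (isColonStep_union hE' he heE).isRegular))
    rwa [Finset.coe_insert, Set.union_insert] at h

lemma numerator_union {d : ℕ} (E : Finset (Finset σ)) (hE : ∀ F ∈ E, F.card = d) :
    numerator K (squarefreeIdeal K ({F | F.card = d + 1} : Set (Finset σ))) =
      numerator K (squarefreeIdeal K ({F | F.card = d + 1} ∪ (E : Set (Finset σ)))) +
      (E.card : PowerSeries ℤ) *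
        (PowerSeries.X ^ d * (1 - PowerSeries.X) ^ (Fintype.card σ - d)) := by
  induction E using Finset.induction_on with
  | empty => simp
  | insert e E heE ih =>
    have he : e.card = d := hE e (Finset.mem_insert_self e E)
    have hE' : ∀ F ∈ E, F.card = d := fun F hF => hE F (Finset.mem_insert_of_mem hF)
    rw [ih hE', (isColonStep_union hE' he heE).numerator, Finset.coe_insert, Set.union_insert,
      Finset.card_insert_of_notMem heE, Finset.card_compl, he]
    push_cast
    ring

omit [LinearOrder σ] in
lemma coe_powersetCard_univ (d : ℕ) :
    (Finset.powersetCard d (Finset.univ : Finset σ) : Set (Finset σ)) = {F | F.card = d} := by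
  ext F
  simp

omit [LinearOrder σ] [Fintype σ] in
lemma squarefreeIdeal_card_zero : squarefreeIdeal K ({F | F.card = 0} : Set (Finset σ)) = ⊤ := by
  rw [eq_top_iff]
  intro p _
  rw [mem_squarefreeIdeal]
  exact fun s _ => ⟨∅, Finset.card_empty, Finset.empty_subset _⟩

lemma isRegular_top : (Grading.standard K σ).IsRegular ⊤ ⊥ 0 := by
  rw [← variableIdeal_empty]
  exact isRegular_variableIdeal ∅

lemma isRegular_card_eq (d : ℕ) :
    (Grading.standard K σ).IsRegular (squarefreeIdeal K {F | F.card = d}) ⊥ d := by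
  induction d with
  | zero =>
    rw [squarefreeIdeal_card_zero]
    exact isRegular_top
  | succ d ih =>
    refine isRegular_of_isRegular_union (Finset.powersetCard d Finset.univ) (by simp) ?_
    rw [coe_powersetCard_univ, squarefreeIdeal_union_card]
    exact ih.mono (Nat.le_succ d)

lemma numerator_card_eq (d : ℕ) :
    numerator K (squarefreeIdeal K ({F | F.card = d} : Set (Finset σ))) =
      ∑ i ∈ Finset.range d, ((Fintype.card σ).choose i : PowerSeries ℤ) * PowerSeries.X ^ i *
        (1 - PowerSeries.X) ^ (Fintype.card σ - i) := by
  induction d with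
  | zero =>
    rw [squarefreeIdeal_card_zero, numerator, sub_self, mul_zero, Finset.sum_range_zero]
  | succ d ih =>
    rw [numerator_union (Finset.powersetCard d Finset.univ) (by simp), coe_powersetCard_univ,
      squarefreeIdeal_union_card, ih, Finset.sum_range_succ, Finset.card_powersetCard,
      Finset.card_univ, mul_assoc]

end Numerator

/-! ### Chordal clutters -/

namespace UniformClutter

variable {K : Type*} [Field K] {n d : ℕ} {C : UniformClutter n d} {e : Finset (Fin n)}

lemma circuitIdeal_eq (C : UniformClutter n d) :
    C.circuitIdeal K = squarefreeIdeal K {F | F.card = d ∧ F ∉ C.circuits} := by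
  unfold circuitIdeal ideal squarefreeIdeal
  congr 1
  ext p
  simp [compl, eq_comm]

lemma IsSimplicial.card_nbhd_compl (he : C.IsSimplicial e) :
    (C.closedNbhd e)ᶜ.card = n + 1 - d - (C.nbhd e).card := by
  have hed := he.1.1
  have : Disjoint e (C.nbhd e) := by
    rw [Finset.disjoint_left]
    intro c hce hc
    have h1 := C.card_eq _ (Finset.mem_filter.1 hc).2
    rw [Finset.union_eq_left.2 (Finset.singleton_subset_iff.2 hce)] at h1
    omega
  rw [Finset.card_compl, closedNbhd, Finset.card_union_of_disjoint this, Fintype.card_fin]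
  omega

/-- As the closed neighborhood of `e` is a clique, no generator of the circuit ideal is supported
in it. -/
lemma IsSimplicial.isColonStep (he : C.IsSimplicial e) :
    IsColonStep {F | F.card = d ∧ F ∉ C.circuits} e (C.closedNbhd e)ᶜ where
  exists_mem := by
    rintro F ⟨hF, hFC⟩
    obtain ⟨c, hcF, hc⟩ := Finset.not_subset.1 fun h => hFC (he.2 F h hF)
    exact ⟨c, Finset.mem_compl.2 hc, hcF, fun h => hc (Finset.mem_union_left _ h)⟩
  exists_subset c hc := by
    rw [Finset.mem_compl, closedNbhd, Finset.mem_union, not_or] at hc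
    refine ⟨insert c e, ⟨?_, fun h => hc.2 (Finset.mem_filter.2 ⟨Finset.mem_univ c, ?_⟩)⟩,
      subset_rfl⟩
    · rw [Finset.card_insert_of_notMem hc.1, he.1.1]
    · rwa [Finset.union_comm, ← Finset.insert_eq]

lemma isColonStep_deletion (he : e.card + 1 = d) :
    IsColonStep {F | F.card = d ∧ F ∉ (C.deletion e).circuits} e eᶜ where
  exists_mem := by
    rintro F ⟨hF, -⟩
    obtain ⟨c, hcF, hce⟩ := Finset.not_subset.1 fun h : F ⊆ e => by
      have := Finset.card_le_card h
      omega
    exact ⟨c, Finset.mem_compl.2 hce, hcF, hce⟩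
  exists_subset c hc := by
    refine ⟨insert c e, ⟨?_, fun h => ?_⟩, subset_rfl⟩
    · rw [Finset.card_insert_of_notMem (Finset.mem_compl.1 hc), he]
    · exact (Finset.mem_filter.1 h).2 (Finset.subset_insert c e)

/-- The circuit ideals of `C` and `C \ e` become equal after the monomial of `e` is added. -/
lemma squarefreeIdeal_insert_deletion :
    squarefreeIdeal K (insert e {F | F.card = d ∧ F ∉ (C.deletion e).circuits}) =
      squarefreeIdeal K (insert e {F | F.card = d ∧ F ∉ C.circuits}) := by
  apply le_antisymm <;> apply squarefreeIdeal_le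
  · rintro F (rfl | ⟨hF, hFC⟩)
    · exact ⟨_, Set.mem_insert _ _, subset_rfl⟩
    · by_cases heF : e ⊆ F
      · exact ⟨e, Set.mem_insert _ _, heF⟩
      · exact ⟨F, Or.inr ⟨hF, fun h => hFC (Finset.mem_filter.2 ⟨h, heF⟩)⟩, subset_rfl⟩
  · rintro F (rfl | ⟨hF, hFC⟩)
    · exact ⟨_, Set.mem_insert _ _, subset_rfl⟩
    · exact ⟨F, Or.inr ⟨hF, fun h => hFC (Finset.mem_filter.1 h).1⟩, subset_rfl⟩

/-- The circuit ideals of `C` and `C \ e` are compared through the ideal `J` that arises by adding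
the monomial of `e`: in both cases the quotient is a polynomial ring, up to a shift. -/
lemma IsSimplicial.isRegular (he : C.IsSimplicial e)
    (h : (Grading.standard K (Fin n)).IsRegular ((C.deletion e).circuitIdeal K) ⊥ d) :
    (Grading.standard K (Fin n)).IsRegular (C.circuitIdeal K) ⊥ d := by
  obtain rfl := he.1.1
  rw [circuitIdeal_eq] at h ⊢
  refine Grading.IsRegular.of_quotient squarefreeIdeal_le_insert ?_ he.isColonStep.isRegular
  rw [← squarefreeIdeal_insert_deletion]
  exact Grading.IsRegular.extension bot_le squarefreeIdeal_le_insert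
    ((isColonStep_deletion he.1.1).isRegular.mono (Nat.le_succ _)) h

lemma IsSimplicial.numerator (he : C.IsSimplicial e) :
    numerator K (C.circuitIdeal K) = numerator K ((C.deletion e).circuitIdeal K) +
      PowerSeries.X ^ (d - 1) * ((1 - PowerSeries.X) ^ (n + 1 - d - (C.nbhd e).card) -
        (1 - PowerSeries.X) ^ (n + 1 - d)) := by
  rw [circuitIdeal_eq, circuitIdeal_eq, he.isColonStep.numerator,
    (isColonStep_deletion he.1.1).numerator, squarefreeIdeal_insert_deletion, he.card_nbhd_compl,
    Finset.card_compl, Fintype.card_fin]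
  have hed := he.1.1
  rw [show e.card = d - 1 by omega, show n - (d - 1) = n + 1 - d by omega]
  ring

lemma circuitIdeal_of_circuits_eq_empty (h : C.circuits = ∅) :
    C.circuitIdeal K = squarefreeIdeal K {F | F.card = d} := by
  rw [circuitIdeal_eq, h]
  simp

lemma isRegular_circuitIdeal {es : List (Finset (Fin n))} (h : C.IsSimplicialOrder es) :
    (Grading.standard K (Fin n)).IsRegular (C.circuitIdeal K) ⊥ d := by
  induction es generalizing C with
  | nil =>
    rw [circuitIdeal_of_circuits_eq_empty h]
    exact isRegular_card_eq d
  | cons e es ih => exact h.1.isRegular (ih h.2)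

lemma numerator_circuitIdeal {es : List (Finset (Fin n))} (h : C.IsSimplicialOrder es) :
    numerator K (C.circuitIdeal K) =
      ∑ i ∈ Finset.range d, (n.choose i : PowerSeries ℤ) * PowerSeries.X ^ i *
        (1 - PowerSeries.X) ^ (n - i) +
      PowerSeries.X ^ (d - 1) * ((C.simplicialMultiset es).map fun k =>
        ((1 - PowerSeries.X) ^ (n + 1 - d - k) - (1 - PowerSeries.X) ^ (n + 1 - d) :
          PowerSeries ℤ)).sum := by
  induction es generalizing C with
  | nil =>
    rw [circuitIdeal_of_circuits_eq_empty h, numerator_card_eq]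
    simp [simplicialMultiset]
  | cons e es ih =>
    rw [h.1.numerator, ih h.2, simplicialMultiset, Multiset.map_cons, Multiset.sum_cons]
    ring

end UniformClutter

/-! ### Linear resolutions -/

namespace Grading

variable {K σ V W ι : Type*} [Field K] [AddCommGroup V] [Module K V]
  [Module (MvPolynomial σ K) V] [AddCommGroup W] [Module K W] [Module (MvPolynomial σ K) W]
  [Fintype ι]

lemma isGradedMap_linearCombination [Finite σ] {G : Grading K σ V} {deg : ι → ℕ} {g : ι → V}
    (hg : ∀ j, g j ∈ G.piece (deg j)) :
    IsGradedMap (free K σ deg) G (Fintype.linearCombination (MvPolynomial σ K) g) := by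
  intro k v hv
  rw [Fintype.linearCombination_apply]
  refine Submodule.sum_mem _ fun j _ => ?_
  rcases mem_free_piece.1 hv j with h | ⟨m, rfl, h⟩
  · rw [h, zero_smul]
    exact zero_mem _
  · exact G.smul_mem h (hg j)

lemma single_mem_free_piece [Finite σ] [DecidableEq ι] (deg : ι → ℕ) (j : ι) :
    Pi.single j 1 ∈ (free K σ deg).piece (deg j) := by
  rw [mem_free_piece]
  intro l
  rcases eq_or_ne l j with rfl | h
  · exact Or.inr ⟨0, rfl, by simpa using isHomogeneous_one σ K⟩
  · exact Or.inl (Pi.single_eq_of_ne h 1)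

variable [LinearOrder σ] [Fintype σ]

/-- The module `Z` vanishes in degrees less than `r` and has regularity at most `r`, that is, its
graded minimal free resolution is `r`-linear. -/
def IsLinear (G : Grading K σ V) (Z : Submodule (MvPolynomial σ K) V) (r : ℕ) : Prop :=
  G.IsRegular Z ⊥ r ∧ ∀ k < r, ∀ v ∈ G.piece k, v ∈ Z → v = 0

lemma isRegular_free {deg : ι → ℕ} {r : ℕ} (h : ∀ j, deg j ≤ r) :
    (free K σ deg).IsRegular ⊤ ⊥ r := by
  intro k hk f hf hDf
  have (j : ι) : ∃ g : Finset σ → MvPolynomial σ K,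
      (∀ T, g T ∈ (standard K σ).piece (k - deg j) ∧ g T ∈ (⊤ : Ideal (MvPolynomial σ K))) ∧
      ∀ T, f T j - Koszul.differential (X : σ → MvPolynomial σ K) g T ∈
        (⊥ : Ideal (MvPolynomial σ K)) := by
    refine isRegular_top (k - deg j) (Nat.zero_le _) (fun T => f T j)
      (fun T => ⟨?_, trivial⟩) fun T => ?_
    · rw [mem_standard_piece]
      rcases mem_free_piece.1 (hf T).1 j with h' | ⟨m, hm, h'⟩
      · rw [h']
        exact isHomogeneous_zero _ _ _
      · convert h'
        have := h j
        omega
    · rw [Submodule.mem_bot]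
      have := congrArg (fun v : ι → MvPolynomial σ K => v j) ((Submodule.mem_bot _).1 (hDf T))
      rw [Pi.zero_apply] at this
      rw [← this]
      exact (Koszul.map_differential X
        (LinearMap.proj j : (ι → MvPolynomial σ K) →ₗ[MvPolynomial σ K] _) f T).symm
  choose g hg hfg using this
  refine ⟨fun T j => g j T, fun T => ⟨mem_free_piece.2 fun j => Or.inr ⟨k - deg j, ?_,
    mem_standard_piece.1 (hg j T).1⟩, trivial⟩, fun T => ?_⟩
  · have := h j
    omega
  · rw [Submodule.mem_bot]
    ext1 j
    refine Eq.trans ?_ ((Submodule.mem_bot _).1 (hfg j T))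
    rw [Pi.sub_apply]
    congr 1
    exact Koszul.map_differential X
      (LinearMap.proj j : (ι → MvPolynomial σ K) →ₗ[MvPolynomial σ K] _) (fun T j => g j T) T

/-- The image of `Z` being linear, a minimal presentation has generators of a single degree, and
the syzygies are again linear, with the degree shifted by one. -/
lemma IsLinear.syzygies {deg : ι → ℕ} {H : Grading K σ W} {r : ℕ}
    {φ : (ι → MvPolynomial σ K) →ₗ[MvPolynomial σ K] W} (hφ : IsGradedMap (free K σ deg) H φ)
    (hmin : ∀ v ∈ LinearMap.ker φ, ∀ j, constantCoeff (v j) = 0)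
    (h : H.IsLinear (LinearMap.range φ) r) :
    (∀ j, deg j = r) ∧ (free K σ deg).IsLinear (LinearMap.ker φ) (r + 1) := by
  classical
  have hdeg (j : ι) : deg j = r := by
    have hj := single_mem_free_piece (K := K) (σ := σ) deg j
    apply le_antisymm
    · by_contra hlt
      obtain ⟨k, hk⟩ : ∃ k, deg j = k + 1 := ⟨deg j - 1, by omega⟩
      have h1 := hφ _ _ hj
      rw [hk] at h1
      obtain ⟨w, hw, hw'⟩ := h.1.exists_sum (by omega) h1 ⟨_, rfl⟩
      choose u huw using fun c => LinearMap.mem_range.1 (hw c).2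
      have h2 : Pi.single j 1 - ∑ c, (X c : MvPolynomial σ K) • u c ∈ LinearMap.ker φ := by
        rw [LinearMap.mem_ker, map_sub, map_sum, hw', sub_eq_zero]
        exact Finset.sum_congr rfl fun c _ => by rw [map_smul, huw]
      have h3 := hmin _ h2 j
      simp at h3
    · by_contra hlt
      have h1 := hmin _ (LinearMap.mem_ker.2 (h.2 _ (not_le.1 hlt) _ (hφ _ _ hj) ⟨_, rfl⟩)) j
      simp at h1
  refine ⟨hdeg, ?_, fun k hk v hv hvφ => ?_⟩
  · refine IsRegular.of_quotient le_top
      ((isRegular_free fun j => (hdeg j).le).mono (Nat.le_succ r)) ?_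
    intro k hk f hf hDf
    obtain ⟨g, hg, hfg⟩ := h.1 k hk (fun T => φ (f T))
      (fun T => ⟨hφ _ _ (hf T).1, ⟨_, rfl⟩⟩) (fun T => by
        rw [Submodule.mem_bot, ← Koszul.map_differential]
        exact hDf T)
    choose u hu hug using fun T => hφ.exists_lift (hg T).1 (hg T).2
    refine ⟨u, fun T => ⟨hu T, trivial⟩, fun T => ?_⟩
    rw [LinearMap.mem_ker, map_sub, Koszul.map_differential]
    simp only [hug]
    exact hfg T
  · ext1 j
    rcases mem_free_piece.1 hv j with h' | ⟨m, hm, h'⟩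
    · exact h'
    · have hm0 : m = 0 := by
        have := hdeg j
        omega
      subst hm0
      have := homogeneousComponent_eq_self h'
      rw [homogeneousComponent_zero, ← constantCoeff_eq, hmin v hvφ j, C_0] at this
      exact this.symm

omit [LinearOrder σ] in
lemma hilbertSeries_free {deg : ι → ℕ} {r : ℕ} (h : ∀ j, deg j = r) :
    (free K σ deg).hilbertSeries ⊤ = (Fintype.card ι : PowerSeries ℤ) *
      (PowerSeries.X ^ r * (standard K σ).hilbertSeries ⊤) := by
  obtain rfl : deg = fun _ => r := _root_.funext h
  rw [← hilbertSeries_shifted]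
  ext k
  rw [← nsmul_eq_mul, map_nsmul, nsmul_eq_mul]
  simp only [hilbertSeries, PowerSeries.coeff_mk]
  have e : ((free K σ fun _ : ι => r).piece k ⊓ (⊤ : Submodule (MvPolynomial σ K)
      (ι → MvPolynomial σ K)).restrictScalars K : Submodule K (ι → MvPolynomial σ K)) ≃ₗ[K]
      (ι → ((shifted K σ r).piece k ⊓
        (⊤ : Ideal (MvPolynomial σ K)).restrictScalars K : Submodule K (MvPolynomial σ K))) :=
    { toFun v j := ⟨v.1 j, v.2.1 j trivial, trivial⟩
      map_add' _ _ := rfl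
      map_smul' _ _ := rfl
      invFun v := ⟨fun j => (v j).1, fun j _ => (v j).2.1, trivial⟩
      left_inv _ := rfl
      right_inv _ := rfl }
  rw [e.finrank_eq, Module.finrank_pi_fintype, Finset.sum_const, Finset.card_univ, smul_eq_mul,
    Nat.cast_mul]

lemma IsLinear.X_pow_dvd [IsScalarTower K (MvPolynomial σ K) V] {G : Grading K σ V}
    {Z : Submodule (MvPolynomial σ K) V} {r : ℕ} (h : G.IsLinear Z r) :
    PowerSeries.X ^ r ∣ G.hilbertSeries Z := by
  rw [PowerSeries.X_pow_dvd_iff]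
  intro k hk
  have : G.piece k ⊓ Z.restrictScalars K = ⊥ := eq_bot_iff.2 fun v hv => h.2 k hk v hv.1 hv.2
  rw [hilbertSeries, PowerSeries.coeff_mk, this, finrank_bot, Nat.cast_zero]

end Grading

lemma Matrix.mulVecLin_eq_linearCombination {R ι κ : Type*} [CommRing R] [Fintype κ]
    (M : Matrix ι κ R) : M.mulVecLin = Fintype.linearCombination R (fun k i => M i k) := by
  ext v i
  simp [Matrix.mulVec, dotProduct, Fintype.linearCombination_apply, mul_comm]

namespace GradedMinimalFreeResolution

variable {K : Type*} [Field K] {n : ℕ} {I : Ideal (MvPolynomial (Fin n) K)}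

instance (F : GradedMinimalFreeResolution I) (i : ℕ) : Fintype (F.ι i) := F.fintype i

variable (F : GradedMinimalFreeResolution I)

lemma isGradedMap_gen : Grading.IsGradedMap (Grading.free K (Fin n) (F.deg 0))
    (Grading.standard K (Fin n)) (Fintype.linearCombination (MvPolynomial (Fin n) K) F.gen) :=
  Grading.isGradedMap_linearCombination fun j =>
    Grading.mem_standard_piece.2 (F.gen_homogeneous j)

lemma isGradedMap_diff (i : ℕ) : Grading.IsGradedMap (Grading.free K (Fin n) (F.deg (i + 1)))
    (Grading.free K (Fin n) (F.deg i)) (F.diff i).mulVecLin := by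
  rw [Matrix.mulVecLin_eq_linearCombination]
  exact Grading.isGradedMap_linearCombination fun k =>
    Grading.mem_free_piece.2 fun j => F.diff_homogeneous i j k

lemma constantCoeff_of_mem_range (i : ℕ) :
    ∀ v ∈ LinearMap.range (F.diff i).mulVecLin, ∀ j, constantCoeff (v j) = 0 := by
  rintro _ ⟨v, rfl⟩ j
  simp [Matrix.mulVec, dotProduct, F.minimal]

lemma range_gen : LinearMap.range (Fintype.linearCombination (MvPolynomial (Fin n) K) F.gen) =
    I := by
  rw [Fintype.range_linearCombination]
  exact F.span_gen

lemma ker_gen : LinearMap.ker (Fintype.linearCombination (MvPolynomial (Fin n) K) F.gen) =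
    LinearMap.range (F.diff 0).mulVecLin :=
  LinearMap.exact_iff.1 F.exact_zero

lemma ker_diff (i : ℕ) : LinearMap.ker (F.diff i).mulVecLin =
    LinearMap.range (F.diff (i + 1)).mulVecLin :=
  LinearMap.exact_iff.1 (F.exact_succ i)

/-- If `I` has regularity `d` and vanishes in smaller degrees, then the first `m` terms of the
resolution determine the Hilbert series of `I` up to degree `d + m`. -/
lemma exists_hilbertSeries_eq {d : ℕ} (hI : (Grading.standard K (Fin n)).IsLinear I d) (m : ℕ) :
    ∃ P, (Grading.standard K (Fin n)).hilbertSeries I =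
      (∑ i ∈ Finset.range m, (-1) ^ i * (F.betti i : PowerSeries ℤ) * PowerSeries.X ^ (i + d)) *
        (Grading.standard K (Fin n)).hilbertSeries ⊤ + PowerSeries.X ^ (d + m) * P := by
  have key (i : ℕ) : (Grading.free K (Fin n) (F.deg i)).IsLinear
        (LinearMap.range (F.diff i).mulVecLin) (d + i + 1) ∧
      (Grading.standard K (Fin n)).hilbertSeries I = (∑ l ∈ Finset.range (i + 1),
        (-1) ^ l * (F.betti l : PowerSeries ℤ) * PowerSeries.X ^ (l + d)) *
        (Grading.standard K (Fin n)).hilbertSeries ⊤ + (-1) ^ (i + 1) *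
        (Grading.free K (Fin n) (F.deg i)).hilbertSeries
          (LinearMap.range (F.diff i).mulVecLin) := by
    induction i with
    | zero =>
      rw [← F.range_gen] at hI
      obtain ⟨hdeg, hlin⟩ := hI.syzygies F.isGradedMap_gen
        (F.ker_gen ▸ F.constantCoeff_of_mem_range 0)
      rw [F.ker_gen] at hlin
      refine ⟨hlin, ?_⟩
      conv_lhs => rw [← F.range_gen]
      rw [Grading.hilbertSeries_range F.isGradedMap_gen, F.ker_gen,
        Grading.hilbertSeries_free hdeg]
      simp only [zero_add, Finset.sum_range_one, betti]
      ring
    | succ i ih =>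
      obtain ⟨hdeg, hlin⟩ := ih.1.syzygies (F.isGradedMap_diff i)
        (F.ker_diff i ▸ F.constantCoeff_of_mem_range (i + 1))
      rw [F.ker_diff] at hlin
      refine ⟨hlin, ?_⟩
      rw [ih.2, Grading.hilbertSeries_range (F.isGradedMap_diff i), F.ker_diff,
        Grading.hilbertSeries_free hdeg, Finset.sum_range_succ _ (i + 1)]
      simp only [betti]
      ring
  cases m with
  | zero =>
    obtain ⟨P, hP⟩ := hI.X_pow_dvd
    exact ⟨P, by simpa using hP⟩
  | succ i =>
    obtain ⟨P, hP⟩ := (key i).1.X_pow_dvd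
    refine ⟨(-1) ^ (i + 1) * P, ?_⟩
    rw [(key i).2, hP]
    ring

/-- The alternating sum of the Betti numbers is the numerator of the Hilbert series, up to
degree `d + m`. -/
lemma X_pow_dvd_sub_numerator {d : ℕ} (hI : (Grading.standard K (Fin n)).IsLinear I d) (m : ℕ) :
    PowerSeries.X ^ (d + m) ∣ (1 + ∑ i ∈ Finset.range m,
      (-1) ^ (i + 1) * (F.betti i : PowerSeries ℤ) * PowerSeries.X ^ (i + d)) -
        numerator K I := by
  obtain ⟨P, hP⟩ := F.exists_hilbertSeries_eq hI m
  refine ⟨(1 - PowerSeries.X) ^ n * P, ?_⟩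
  have h1 := one_sub_X_pow_mul_hilbertSeries_top (K := K) (σ := Fin n)
  rw [Fintype.card_fin] at h1
  have h2 : ∑ i ∈ Finset.range m,
      (-1) ^ (i + 1) * (F.betti i : PowerSeries ℤ) * PowerSeries.X ^ (i + d) =
      -∑ i ∈ Finset.range m,
        (-1) ^ i * (F.betti i : PowerSeries ℤ) * PowerSeries.X ^ (i + d) := by
    rw [← Finset.sum_neg_distrib]
    exact Finset.sum_congr rfl fun i _ => by ring
  rw [numerator_eq, Fintype.card_fin, hP, h2]
  linear_combination (∑ i ∈ Finset.range m,
    (-1) ^ i * (F.betti i : PowerSeries ℤ) * PowerSeries.X ^ (i + d)) * h1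

end GradedMinimalFreeResolution

/-! ### Existence of minimal resolutions -/

namespace Grading

variable {K σ V : Type*} [Field K] [Finite σ] [AddCommGroup V] [Module K V]
  [Module (MvPolynomial σ K) V]

/-- A finitely generated homogeneous submodule is generated by finitely many homogeneous elements
without a relation that has an invertible coefficient. -/
lemma IsHomogeneous.exists_minimal_generators {G : Grading K σ V}
    {Z : Submodule (MvPolynomial σ K) V} (hZ : G.IsHomogeneous Z) (hfg : Z.FG) :
    ∃ (N : ℕ) (deg : Fin N → ℕ) (g : Fin N → V), (∀ j, g j ∈ G.piece (deg j)) ∧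
      LinearMap.range (Fintype.linearCombination (MvPolynomial σ K) g) = Z ∧
      ∀ v ∈ LinearMap.ker (Fintype.linearCombination (MvPolynomial σ K) g),
        ∀ j, constantCoeff (v j) = 0 := by
  classical
  let P (N : ℕ) : Prop := ∃ T : Finset V, T.card = N ∧ (∀ z ∈ T, ∃ k, z ∈ G.piece k) ∧
    Submodule.span (MvPolynomial σ K) (T : Set V) = Z
  have hP : ∃ N, P N := by
    obtain ⟨S, hS⟩ := hfg
    choose B hB using fun v => (G.sum_proj v).exists
    refine ⟨_, S.biUnion fun v => (Finset.range (B v)).image fun k => G.proj k v, rfl, ?_, ?_⟩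
    · intro z hz
      simp only [Finset.mem_biUnion, Finset.mem_image] at hz
      obtain ⟨v, -, k, -, rfl⟩ := hz
      exact ⟨k, G.proj_mem k v⟩
    · apply le_antisymm
      · rw [Submodule.span_le]
        intro z hz
        simp only [Finset.mem_coe, Finset.mem_biUnion, Finset.mem_image] at hz
        obtain ⟨v, hv, k, -, rfl⟩ := hz
        exact hZ v (hS ▸ Submodule.subset_span hv) k
      · rw [← hS, Submodule.span_le]
        intro v hv
        rw [SetLike.mem_coe, ← hB v]
        refine Submodule.sum_mem _ fun k hk => Submodule.subset_span ?_
        simp only [Finset.mem_coe, Finset.mem_biUnion, Finset.mem_image]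
        exact ⟨v, hv, k, hk, rfl⟩
  -- A generating set of homogeneous elements with the least possible number of elements.
  obtain ⟨T, hTN, hT, hTZ⟩ := Nat.find_spec hP
  have hmin : ∀ T' : Finset V, T' ⊂ T →
      Submodule.span (MvPolynomial σ K) (T' : Set V) ≠ Z := fun T' hT' hT'Z =>
    Nat.find_min hP (hTN ▸ Finset.card_lt_card hT') ⟨T', rfl, fun z hz => hT z (hT'.1 hz), hT'Z⟩
  let g : Fin T.card → V := fun j => (T.equivFin.symm j : V)
  choose deg hdeg using fun j => hT (g j) (T.equivFin.symm j).2
  have hrange : Set.range g = T := by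
    ext z
    constructor
    · rintro ⟨j, rfl⟩
      exact (T.equivFin.symm j).2
    · intro hz
      exact ⟨T.equivFin ⟨z, hz⟩, by simp [g]⟩
  refine ⟨T.card, deg, g, hdeg, by rw [Fintype.range_linearCombination, hrange, hTZ], ?_⟩
  intro v hv j
  by_contra hc
  refine hmin (T.erase (g j)) (Finset.erase_ssubset (T.equivFin.symm j).2) ?_
  rw [← hTZ]
  refine le_antisymm (Submodule.span_mono (by simp)) (Submodule.span_le.2 fun z hz => ?_)
  by_cases hzj : z = g j
  · -- In the component of degree `deg j` of the relation the coefficient of `g j` is a constant.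
    have hw := (isGradedMap_linearCombination hdeg).isHomogeneous_ker v hv (deg j)
    set w := (free K σ deg).proj (deg j) v
    have hwj : w j = C (constantCoeff (v j)) := by
      simp [w, pi, shifted, homogeneousComponent_zero, constantCoeff_eq]
    rw [LinearMap.mem_ker, Fintype.linearCombination_apply,
      ← Finset.add_sum_erase _ _ (Finset.mem_univ j), hwj, add_eq_zero_iff_eq_neg] at hw
    have hmem : (C (constantCoeff (v j)) : MvPolynomial σ K) • g j ∈
        Submodule.span (MvPolynomial σ K) ((T.erase (g j) : Finset V) : Set V) := by
      rw [hw]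
      refine neg_mem (Submodule.sum_mem _ fun l hl => Submodule.smul_mem _ _
        (Submodule.subset_span (Finset.mem_coe.2 (Finset.mem_erase.2
          ⟨fun h => Finset.ne_of_mem_erase hl ?_, (T.equivFin.symm l).2⟩))))
      exact T.equivFin.symm.injective (Subtype.ext h)
    have := Submodule.smul_mem _ (C (constantCoeff (v j))⁻¹) hmem
    rw [smul_smul, ← C_mul, inv_mul_cancel₀ hc, C_1, one_smul] at this
    rw [hzj]
    exact this
  · exact Submodule.subset_span (Finset.mem_coe.2 (Finset.mem_erase.2 ⟨hzj, hz⟩))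

end Grading

/-- A graded free module together with a homogeneous submodule `ker` of its multiple by the
irrelevant ideal: a step of a minimal resolution and the syzygies that remain to be resolved. -/
structure ResolutionStep (K : Type*) [Field K] (n : ℕ) where
  ι : Type
  [fintype : Fintype ι]
  deg : ι → ℕ
  ker : Submodule (MvPolynomial (Fin n) K) (ι → MvPolynomial (Fin n) K)
  isHomogeneous : (Grading.free K (Fin n) deg).IsHomogeneous ker
  constantCoeff_eq_zero : ∀ v ∈ ker, ∀ j, constantCoeff (v j) = 0

namespace ResolutionStep

variable {K : Type*} [Field K] {n : ℕ}

instance (s : ResolutionStep K n) : Fintype s.ι := s.fintype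

lemma exists_next (s : ResolutionStep K n) :
    ∃ (t : ResolutionStep K n) (M : Matrix s.ι t.ι (MvPolynomial (Fin n) K)),
      (∀ j k, M j k = 0 ∨ ∃ m, t.deg k = s.deg j + m ∧ (M j k).IsHomogeneous m) ∧
      LinearMap.range M.mulVecLin = s.ker ∧ LinearMap.ker M.mulVecLin = t.ker := by
  obtain ⟨N, deg, g, hdeg, hrange, hker⟩ :=
    s.isHomogeneous.exists_minimal_generators (IsNoetherian.noetherian s.ker)
  let M : Matrix s.ι (Fin N) (MvPolynomial (Fin n) K) := Matrix.of fun j k => g k j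
  have hM : M.mulVecLin = Fintype.linearCombination (MvPolynomial (Fin n) K) g :=
    M.mulVecLin_eq_linearCombination
  exact ⟨⟨Fin N, deg, _, (Grading.isGradedMap_linearCombination hdeg).isHomogeneous_ker, hker⟩,
    M, fun j k => Grading.mem_free_piece.1 (hdeg k) j, (congrArg LinearMap.range hM).trans hrange,
    congrArg LinearMap.ker hM⟩

/-- A next step of a minimal resolution. -/
noncomputable def next (s : ResolutionStep K n) : ResolutionStep K n := s.exists_next.choose

/-- The differential from the next step. -/
noncomputable def diff (s : ResolutionStep K n) :
    Matrix s.ι s.next.ι (MvPolynomial (Fin n) K) := s.exists_next.choose_spec.choose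

lemma diff_spec (s : ResolutionStep K n) :
    (∀ j k, s.diff j k = 0 ∨
      ∃ m, s.next.deg k = s.deg j + m ∧ (s.diff j k).IsHomogeneous m) ∧
    LinearMap.range s.diff.mulVecLin = s.ker ∧ LinearMap.ker s.diff.mulVecLin = s.next.ker :=
  s.exists_next.choose_spec.choose_spec

lemma constantCoeff_diff (s : ResolutionStep K n) (j : s.ι) (k : s.next.ι) :
    constantCoeff (s.diff j k) = 0 := by
  classical
  have h : s.diff.mulVecLin (Pi.single k 1) ∈ s.ker := by
    rw [← s.diff_spec.2.1]
    exact ⟨_, rfl⟩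
  simpa using s.constantCoeff_eq_zero _ h j

/-- The `i`-th step of a minimal resolution that starts with `s`. -/
noncomputable def iterate (s : ResolutionStep K n) (i : ℕ) : ResolutionStep K n :=
  i.rec s fun _ t => t.next

end ResolutionStep

lemma nonempty_gradedMinimalFreeResolution {K : Type*} [Field K] {n : ℕ}
    {I : Ideal (MvPolynomial (Fin n) K)} (hI : (Grading.standard K (Fin n)).IsHomogeneous I) :
    Nonempty (GradedMinimalFreeResolution I) := by
  obtain ⟨N, deg, g, hdeg, hrange, hker⟩ :=
    hI.exists_minimal_generators (IsNoetherian.noetherian I)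
  let s : ResolutionStep K n :=
    ⟨Fin N, deg, _, (Grading.isGradedMap_linearCombination hdeg).isHomogeneous_ker, hker⟩
  exact ⟨{
    ι := fun i => (s.iterate i).ι
    deg := fun i => (s.iterate i).deg
    gen := g
    diff := fun i => (s.iterate i).diff
    gen_homogeneous := fun j => Grading.mem_standard_piece.1 (hdeg j)
    diff_homogeneous := fun i => (s.iterate i).diff_spec.1
    span_gen := by
      rw [← hrange, Fintype.range_linearCombination]
      rfl
    exact_zero := LinearMap.exact_iff.2 (s.diff_spec.2.1).symm
    exact_succ := fun i => LinearMap.exact_iff.2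
      ((s.iterate i).diff_spec.2.2.trans (s.iterate i).next.diff_spec.2.1.symm)
    minimal := fun i => (s.iterate i).constantCoeff_diff }⟩

/-! ### The Betti polynomial of a chordal clutter -/

namespace UniformClutter

variable {K : Type*} [Field K] {n d : ℕ} {C : UniformClutter n d}

/-- The circuit ideal of a chordal clutter has a linear resolution. -/
lemma isLinear_circuitIdeal {es : List (Finset (Fin n))} (h : C.IsSimplicialOrder es) :
    (Grading.standard K (Fin n)).IsLinear (C.circuitIdeal K) d := by
  refine ⟨isRegular_circuitIdeal h, fun k hk p hp hpC => ?_⟩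
  rw [circuitIdeal_eq, mem_squarefreeIdeal] at hpC
  rw [Grading.mem_standard_piece] at hp
  rw [← support_eq_empty, Finset.eq_empty_iff_forall_notMem]
  intro s hs
  obtain ⟨F, ⟨hF, -⟩, hFs⟩ := hpC s hs
  have h1 := Finset.card_le_card hFs
  have h2 := hp.degree_eq_sum_deg_support hs
  have h3 : s.support.card ≤ ∑ i ∈ s.support, s i := by
    rw [Finset.card_eq_sum_ones]
    exact Finset.sum_le_sum fun i hi =>
      Nat.one_le_iff_ne_zero.2 (Finsupp.mem_support_iff.1 hi)
  omega

end UniformClutter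

theorem corollary3p1 {K : Type*} [Field K] {n d : ℕ} (hd : 1 ≤ d) (C : UniformClutter n d)
    (hC : C.IsChordal) (N : Multiset ℕ) (hN : C.HasMultiset N) :
    Nonempty (GradedMinimalFreeResolution (C.circuitIdeal K)) ∧
    ∀ F : GradedMinimalFreeResolution (C.circuitIdeal K),
      (1 + ∑ i ∈ Finset.range n,
          (-1) ^ (i + 1) * (F.betti i : Polynomial ℤ) * Polynomial.X ^ (i + d) : Polynomial ℤ) =
        ∑ i ∈ Finset.range d,
          (n.choose i : Polynomial ℤ) * Polynomial.X ^ i * (1 - Polynomial.X) ^ (n - i) +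
        Polynomial.X ^ (d - 1) *
          (N.map fun k => ((1 - Polynomial.X) ^ (n + 1 - d - k) -
            (1 - Polynomial.X) ^ (n + 1 - d) : Polynomial ℤ)).sum := by
  obtain ⟨es, hes, rfl⟩ := hN
  refine ⟨nonempty_gradedMinimalFreeResolution ?_, fun F => ?_⟩
  · rw [UniformClutter.circuitIdeal_eq]
    exact isHomogeneous_squarefreeIdeal _
  -- Both sides have degree less than `d + n`, and they agree as power series up to that degree.
  refine eq_of_X_pow_dvd_coe_sub (m := d + n) (natDegree_one_add_sum_lt hd _)
    ((Polynomial.natDegree_add_le_of_degree_le (natDegree_sum_choose_le n d)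
      (natDegree_X_pow_mul_sum_le hd _)).trans_lt (by omega)) ?_
  have h := F.X_pow_dvd_sub_numerator (UniformClutter.isLinear_circuitIdeal hes) n
  rw [UniformClutter.numerator_circuitIdeal hes] at h
  simp only [← Polynomial.coeToPowerSeries.ringHom_apply, map_add, map_mul, map_sum,
    map_multiset_sum, Multiset.map_map, Function.comp_def, map_sub, map_pow, map_one, map_neg,
    map_natCast]
  simpa only [Polynomial.coeToPowerSeries.ringHom_apply, Polynomial.coe_X] using h
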